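/- Let $G=(V,E)$ be a connected, locally finite graph with symmetric edge weights $\omega_{xy}=\omega_{yx}>0$, and let $\mu:V\to(0,\infty)$ satisfy $\mu(x)\ge\mu_0>0$ for all $x\in V$. Write $\int_V u\,d\mu=\sum_{x\in V}u(x)\mu(x)$, let $L^r(V)$ be the corresponding Lebesgue spaces ($1\le r<\infty$), $\|u\|_\infty=\sup_{x\in V}|u(x)|$, $$\Gamma(u,v)(x)=\frac1{2\mu(x)}\sum_{y\sim x}\omega_{xy}(u(y)-u(x))(v(y)-v(x)),\qquad |\nabla u|=\sqrt{\Gamma(u,u)},$$ and for $p>1$ $$\Delta_pu(x)=\frac1{2\mu(x)}\sum_{y\sim x}\bigl(|\nabla u|^{p-2}(y)+|\nabla u|^{p-2}(x)\bigr)\omega_{xy}(u(y)-u(x))$$ (where for $p<2$ terms with $u(y)=u(x)$ are read as $0$; likewise $|u|^{p-2}u$ is read as $0$ where $u=0$, and $|\nabla u|^{p-2}\Gamma(u,\phi)$ as $0$ where $|\nabla u|=0$). Let $W^{1,p}(V)$ be the completion of the finitely supported functions under $\|u\|_{W^{1,p}}=\bigl(\int_V(|\nabla u|^p+|u|^p)\,d\mu\bigr)^{1/p}$,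 and $W^{1,p}_h(V)=\{u\in W^{1,p}(V):\int_V h|u|^p\,d\mu<\infty\}$. **Theorem 1.4.** Let $p>1$, $h:V\to\mathbb R$, $F:V\times\mathbb R\to\mathbb R$ and $e\in L^{p/(p-1)}(V)$. Write $F_s(x,s)=\partial F(x,s)/\partial s$. Assume: - $(h_1)$ there is a constant $h_0>0$ with $h(x)\ge h_0$ for all $x\in V$; - $(h_2)$ $h(x)\to\infty$ as $\mathrm{dist}(x,x_0)\to\infty$ for some fixed $x_0\in V$, where $\mathrm{dist}$ is the graph distance; - $(f_0)$ for all $x\in V$, $F(x,\cdot)$ is continuously differentiable, and there are a continuous $a:[0,\infty)\to[0,\infty)$ and $b:V\to[0,\infty)$, $b\in L^1(V)$, such that $|F_s(x,s)|\le a(|s|)b(x)$ and $|F(x,s)|\le a(|s|)b(x)$ for all $x\in V$, $s\in\mathbb R$; - $(f_1)$ $F(x,0)=0$ for all $x\in V$, and there are $f_1,g_1:V\to[0,\infty)$ with $f_1\in L^\infty(V)$, $\|f_1\|_\infty<h_0$ and $g_1\in L^{p/(p-1)}(V)$ such that $|F_s(x,s)|\le f_1(x)|s|^{p-1}+g_1(x)$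 for all $x\in V$, $s\in\mathbb R$; - $(f_2)$ there are $\beta_1>1$ and $K_1:V\to\mathbb R$ such that $K_1(x_1)>0$ for some $x_1\in V$ with $e(x_1)>0$, and $F(x,s)\ge-K_1(x)|s|^{\beta_1}$ for all $x\in V$, $s\in\mathbb R$. Then for every $\varepsilon>0$ the equation $$-\Delta_pu+h(x)|u|^{p-2}u=F_s(x,u)+\varepsilon e(x),\qquad x\in V,$$ has at least one nontrivial solution: there is $u\in W^{1,p}_h(V)$, $u\not\equiv0$, which satisfies the equation at every vertex and is a weak solution, that is, $$\int_V\bigl(|\nabla u|^{p-2}\Gamma(u,\phi)+h|u|^{p-2}u\phi\bigr)d\mu=\int_V\bigl(F_s(x,u)+\varepsilon e\bigr)\phi\,d\mu\qquad\text{for all }\phi\in W^{1,p}_h(V),$$ where both integrals converge absolutely. -/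

import Mathlib

open Filter Topology

noncomputable section

namespace GraphPLaplace

variable {V : Type*} (G : SimpleGraph V) [G.LocallyFinite]

/-- The gradient form `Γ(u,v)(x) = (1 / (2 μ(x))) ∑_{y ~ x} ω_{xy} (u(y) - u(x)) (v(y) - v(x))`. -/
def gradForm (ω : V → V → ℝ) (μ : V → ℝ) (u v : V → ℝ) (x : V) : ℝ :=
  1 / (2 * μ x) * ∑ y ∈ G.neighborFinset x, ω x y * (u y - u x) * (v y - v x)

/-- The length of the gradient, `|∇u|(x) = √(Γ(u,u)(x))`. -/
def gradLen (ω : V → V → ℝ) (μ : V → ℝ) (u : V → ℝ) (x : V) : ℝ :=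
  √(gradForm G ω μ u u x)

/-- The `p`-Laplacian
`Δ_p u(x) = (1 / (2 μ(x))) ∑_{y ~ x} (|∇u|^{p-2}(y) + |∇u|^{p-2}(x)) ω_{xy} (u(y) - u(x))`.
(If `|∇u|` vanishes at `x` or at `y`, then `u(y) = u(x)`, so for `p < 2` the value given to
`0 ^ (p - 2)` plays no role.) -/
def pLaplacian (ω : V → V → ℝ) (μ : V → ℝ) (p : ℝ) (u : V → ℝ) (x : V) : ℝ :=
  1 / (2 * μ x) * ∑ y ∈ G.neighborFinset x,
    (gradLen G ω μ u y ^ (p - 2) + gradLen G ω μ u x ^ (p - 2)) * ω x y * (u y - u x)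

/-- `∫_V u dμ = ∑_{x ∈ V} u(x) μ(x)` converges absolutely. -/
def IntegrableV (μ : V → ℝ) (u : V → ℝ) : Prop :=
  Summable fun x => u x * μ x

/-- `∫_V u dμ = ∑_{x ∈ V} u(x) μ(x)`. -/
def integralV (μ : V → ℝ) (u : V → ℝ) : ℝ :=
  ∑' x, u x * μ x

/-- `u ∈ L^r(V)` for a finite exponent `r`: `∫_V |u|^r dμ < ∞`. -/
def MemLr (μ : V → ℝ) (r : ℝ) (u : V → ℝ) : Prop :=
  IntegrableV μ fun x => |u x| ^ r

/-- `u ∈ L^∞(V)`. -/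
def MemLinfty (u : V → ℝ) : Prop :=
  BddAbove (Set.range fun x => |u x|)

/-- `‖u‖_∞ = sup_x |u(x)|`. -/
def linftyNorm (u : V → ℝ) : ℝ :=
  ⨆ x, |u x|

/-- `‖u‖_{W^{1,p}(V)} = (∫_V |∇u|^p + |u|^p dμ)^{1/p}`. -/
def sobolevNorm (ω : V → V → ℝ) (μ : V → ℝ) (p : ℝ) (u : V → ℝ) : ℝ :=
  (integralV μ fun x => gradLen G ω μ u x ^ p + |u x| ^ p) ^ (1 / p)

/-- The norm `‖u‖_{W^{1,p}(V)}` is finite. -/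
def FiniteSobolevNorm (ω : V → V → ℝ) (μ : V → ℝ) (p : ℝ) (u : V → ℝ) : Prop :=
  IntegrableV μ fun x => gradLen G ω μ u x ^ p + |u x| ^ p

/-- `u ∈ W^{1,p}(V)`, the completion of the space `C_c(V)` of finitely supported functions under
`‖·‖_{W^{1,p}(V)}`. As `μ` is bounded below by a positive constant, convergence in this norm
implies pointwise convergence, and the completion consists of the functions of finite norm that
are limits in norm of finitely supported functions. -/
def MemW (ω : V → V → ℝ) (μ : V → ℝ) (p : ℝ) (u : V → ℝ) : Prop :=
  FiniteSobolevNorm G ω μ p u ∧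
    ∀ δ > 0, ∃ φ : V → ℝ, φ.support.Finite ∧
      FiniteSobolevNorm G ω μ p (u - φ) ∧ sobolevNorm G ω μ p (u - φ) < δ

/-- `u ∈ W_h^{1,p}(V)`: `u ∈ W^{1,p}(V)` and `∫_V h |u|^p dμ < ∞`. -/
def MemWh (ω : V → V → ℝ) (μ : V → ℝ) (p : ℝ) (h : V → ℝ) (u : V → ℝ) : Prop :=
  MemW G ω μ p u ∧ IntegrableV μ fun x => h x * |u x| ^ p

/-- `u` satisfies `-Δ_p u + h |u|^{p-2} u = f(x,u)` at every vertex. -/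
def IsPointwiseSolution (ω : V → V → ℝ) (μ : V → ℝ) (p : ℝ) (h : V → ℝ) (f : V → ℝ → ℝ)
    (u : V → ℝ) : Prop :=
  ∀ x, -pLaplacian G ω μ p u x + h x * |u x| ^ (p - 2) * u x = f x (u x)

/-- `u ∈ W_h^{1,p}(V)` is a weak solution of `-Δ_p u + h |u|^{p-2} u = f(x,u)`: for every
`φ ∈ W_h^{1,p}(V)`,
`∫_V (|∇u|^{p-2} Γ(u,φ) + h |u|^{p-2} u φ) dμ = ∫_V f(x,u) φ dμ`, where both integrals converge.
(Where `|∇u|(x) = 0` also `Γ(u,φ)(x) = 0`.) -/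
def IsWeakSolution (ω : V → V → ℝ) (μ : V → ℝ) (p : ℝ) (h : V → ℝ) (f : V → ℝ → ℝ)
    (u : V → ℝ) : Prop :=
  MemWh G ω μ p h u ∧
    ∀ φ : V → ℝ, MemWh G ω μ p h φ →
      IntegrableV μ (fun x => gradLen G ω μ u x ^ (p - 2) * gradForm G ω μ u φ x
        + h x * |u x| ^ (p - 2) * u x * φ x) ∧
      IntegrableV μ (fun x => f x (u x) * φ x) ∧
      integralV μ (fun x => gradLen G ω μ u x ^ (p - 2) * gradForm G ω μ u φ x
        + h x * |u x| ^ (p - 2) * u x * φ x) =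
      integralV μ (fun x => f x (u x) * φ x)

end GraphPLaplace

end

/-! Solutions are built by exhausting `V` by finite sets. On functions supported in a finite `S`,
the functional J(u) = (1/p) ∫ (|∇u|^p + h|u|^p) - ∫ Φ(x,u), with Φ' = f, depends continuously on
finitely many variables. Since |f(x,s)| ≤ M|s|^(p-1) + g(x) with M < h₀, it is coercive. Hence a
minimizer v_S exists and solves the equation tested on `S`; comparison with 0 gives J(v_S) ≤ 0, and
so an energy bound independent of `S` (`exists_solution_on_finset`).

Bounded energy confines the v_S to a compact product of intervals, so they converge pointwise to
some u along an ultrafilter. Against a finitely supported test function the equation is a finite sum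
and passes to the limit. That u is a norm limit of finitely supported functions comes from comparing
energies. Testing the equation of v_S with v_S gives energy(v_S) = ∫ f(v_S) v_S, which tends to ∫
f(u) u because h → ∞ keeps mass from escaping (`tendsto_tsum_nonlinearity`). Testing the equation of
u with v_S and passing to the limit gives energy(u) = ∫ f(u) u. Pointwise convergence plus
convergence of energies is norm convergence (`memWh_of_tendsto`). General test functions are reached
through approximants truncated by the test function (`exists_finite_support_approx`), and vertex
indicators yield the pointwise equation.

The solution is nontrivial because F(x,s) ≥ -K|s|^β with β > 1 forces F_s(x,0) = 0, so 0 would solve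
the equation at x₁ only if ε e(x₁) = 0. -/

namespace GraphPLaplace

/-! ### Convergence of infinite sums; Young's inequality -/

/-- Sums of pointwise convergent families with uniformly small tails converge. -/
theorem tendsto_tsum_of_tails {ι V : Type*} {l : Filter ι} [l.NeBot] {f : ι → V → ℝ} {g : V → ℝ}
    (hf : ∀ i, Summable (f i)) (hfg : ∀ x, Tendsto (fun i => f i x) l (𝓝 (g x)))
    (tail : ∀ δ > 0, ∃ S : Finset V, ∀ᶠ i in l, ∀ T, Disjoint T S → ∑ x ∈ T, |f i x| ≤ δ) :
    Summable g ∧ Tendsto (fun i => ∑' x, f i x) l (𝓝 (∑' x, g x)) := by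
  classical
  have tailg : ∀ δ > 0, ∃ S : Finset V, (∀ᶠ i in l, ∀ T, Disjoint T S → ∑ x ∈ T, |f i x| ≤ δ) ∧
      ∀ T, Disjoint T S → ∑ x ∈ T, |g x| ≤ δ := by
    intro δ hδ
    obtain ⟨S, hS⟩ := tail δ hδ
    refine ⟨S, hS, fun T hT => ?_⟩
    refine le_of_tendsto (f := fun i => ∑ x ∈ T, |f i x|)
      (tendsto_finsetSum _ fun x _ => (hfg x).abs) ?_
    filter_upwards [hS] with i hi using hi T hT
  have hg : Summable g := by
    rw [summable_iff_vanishing_norm]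
    intro δ hδ
    obtain ⟨S, -, hS⟩ := tailg (δ / 2) (by positivity)
    refine ⟨S, fun T hT => ?_⟩
    have := hS T hT
    have h2 := Finset.abs_sum_le_sum_abs g T
    rw [Real.norm_eq_abs]
    linarith
  have key : ∀ (k : V → ℝ) (S : Finset V) (δ : ℝ), Summable k →
      (∀ T, Disjoint T S → ∑ x ∈ T, |k x| ≤ δ) → |∑' x, k x - ∑ x ∈ S, k x| ≤ δ := by
    intro k S δ hk hT
    have h1 : Tendsto (fun T : Finset V => |∑ x ∈ T, k x - ∑ x ∈ S, k x|) atTop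
        (𝓝 |∑' x, k x - ∑ x ∈ S, k x|) := (hk.hasSum.sub_const _).abs
    refine le_of_tendsto h1 ?_
    filter_upwards [eventually_ge_atTop S] with T hST
    rw [← Finset.sum_sdiff hST, add_sub_cancel_right]
    exact (Finset.abs_sum_le_sum_abs _ _).trans (hT _ Finset.sdiff_disjoint)
  refine ⟨hg, ?_⟩
  rw [Metric.tendsto_nhds]
  intro δ hδ
  obtain ⟨S, hS, hSg⟩ := tailg (δ / 4) (by positivity)
  have h1 : Tendsto (fun i => ∑ x ∈ S, f i x) l (𝓝 (∑ x ∈ S, g x)) :=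
    tendsto_finsetSum _ fun x _ => hfg x
  rw [Metric.tendsto_nhds] at h1
  filter_upwards [hS, h1 (δ / 4) (by positivity)] with i hi h2
  have h3 := key _ _ _ (hf i) hi
  have h4 := key _ _ _ hg hSg
  rw [Real.dist_eq] at h2 ⊢
  rw [abs_le] at h3 h4
  rw [abs_lt] at h2 ⊢
  constructor <;> linarith

/-- Tails of a summable family of nonnegative reals are small. -/
theorem exists_tail_le {V : Type*} {a : V → ℝ} (ha : Summable a) {δ : ℝ}
    (hδ : 0 < δ) : ∃ S : Finset V, ∀ T, Disjoint T S → ∑ x ∈ T, a x ≤ δ := by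
  obtain ⟨S, hS⟩ := summable_iff_vanishing_norm.1 ha δ hδ
  exact ⟨S, fun T hT => (le_abs_self _).trans (hS T hT).le⟩

/-- If `a i → a` pointwise and in total mass, and `|b i| ≤ C (a i + a)` with `b i → 0` pointwise,
then the sums of `b i` tend to zero. -/
theorem tendsto_tsum_zero_of_le {ι V : Type*} {l : Filter ι} [l.NeBot] {a : ι → V → ℝ}
    {a₀ : V → ℝ} {b : ι → V → ℝ} {C : ℝ} (hC : 0 ≤ C) (ha : ∀ i, Summable (a i))
    (ha₀ : Summable a₀) (hpt : ∀ x, Tendsto (fun i => a i x) l (𝓝 (a₀ x)))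
    (hsum : Tendsto (fun i => ∑' x, a i x) l (𝓝 (∑' x, a₀ x)))
    (a_nonneg : ∀ i x, 0 ≤ a i x)
    (hb : ∀ i x, |b i x| ≤ C * (a i x + a₀ x)) (hb0 : ∀ x, Tendsto (fun i => b i x) l (𝓝 0)) :
    (∀ i, Summable (b i)) ∧ Tendsto (fun i => ∑' x, b i x) l (𝓝 0) := by
  classical
  have hbs : ∀ i, Summable (b i) := fun i =>
    Summable.of_norm_bounded (((ha i).add ha₀).mul_left C) (hb i)
  refine ⟨hbs, ?_⟩
  have := (tendsto_tsum_of_tails (g := fun _ => 0) hbs hb0 ?_).2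
  · simpa using this
  intro δ hδ
  -- Outside `S` the family will carry at most 2η and its limit at most η; `C + 1` avoids dividing
  -- by zero.
  set η := δ / (4 * (C + 1)) with hη
  have hη0 : 0 < η := by positivity
  have hCη : C * (4 * η) ≤ δ := by
    rw [hη]; field_simp; linarith
  obtain ⟨S, hS⟩ := exists_tail_le ha₀ hη0
  refine ⟨S, ?_⟩
  have h1 : Tendsto (fun i => ∑ x ∈ S, a i x) l (𝓝 (∑ x ∈ S, a₀ x)) :=
    tendsto_finsetSum _ fun x _ => hpt x
  -- The mass outside `S` is total mass minus mass on `S`, and both converge: this is where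
  -- convergence of the total mass excludes escape to infinity.
  have h2 := (hsum.sub h1).eventually_lt_const
    (show ∑' x, a₀ x - ∑ x ∈ S, a₀ x < 2 * η from ?_)
  · filter_upwards [h2] with i hi T hT
    have h3 : ∑ x ∈ T, a i x ≤ 2 * η := by
      have h4 : ∑ x ∈ T ∪ S, a i x ≤ ∑' x, a i x := (ha i).sum_le_tsum _ fun x _ => a_nonneg i x
      rw [Finset.sum_union hT] at h4
      linarith
    calc ∑ x ∈ T, |b i x| ≤ ∑ x ∈ T, C * (a i x + a₀ x) := Finset.sum_le_sum fun x _ => hb i x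
      _ = C * (∑ x ∈ T, a i x + ∑ x ∈ T, a₀ x) := by
        rw [← Finset.mul_sum, Finset.sum_add_distrib]
      _ ≤ C * (4 * η) := by
        have := hS T hT
        gcongr; linarith
      _ ≤ δ := hCη
  · have h5 : ∑' x, a₀ x ≤ ∑ x ∈ S, a₀ x + η := by
      refine le_of_tendsto ha₀.hasSum ?_
      filter_upwards [eventually_ge_atTop S] with T hST
      rw [← Finset.sum_sdiff hST]
      have := hS _ (Finset.sdiff_disjoint (s := S) (t := T))
      linarith
    linarith

theorem add_rpow_le {a b r : ℝ} (ha : 0 ≤ a) (hb : 0 ≤ b) (hr : 0 ≤ r) :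
    (a + b) ^ r ≤ 2 ^ r * (a ^ r + b ^ r) := by
  have h1 := Real.rpow_nonneg ha r
  have h2 := Real.rpow_nonneg hb r
  rcases le_total a b with hab | hab
  · calc (a + b) ^ r ≤ (2 * b) ^ r := by gcongr; linarith
      _ = 2 ^ r * b ^ r := Real.mul_rpow (by norm_num) hb
      _ ≤ _ := by gcongr; linarith
  · calc (a + b) ^ r ≤ (2 * a) ^ r := by gcongr; linarith
      _ = 2 ^ r * a ^ r := Real.mul_rpow (by norm_num) ha
      _ ≤ _ := by gcongr; linarith

/-- Young's inequality with a small parameter. -/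
theorem exists_young {p δ : ℝ} (hp : 1 < p) (hδ : 0 < δ) :
    ∃ K : ℝ, 0 ≤ K ∧ ∀ a b : ℝ, 0 ≤ a → 0 ≤ b → a * b ≤ K * a ^ (p / (p - 1)) + δ * b ^ p := by
  have hp0 : 0 < p := by linarith
  have hpq : (p / (p - 1)).HolderConjugate p := (Real.HolderConjugate.conjExponent hp).symm
  set q := p / (p - 1) with hq
  -- Young's inequality for `c⁻¹ * a` and `c * b` has second term c^p b^p / p, which equals δ b^p
  -- for this `c`.
  set c : ℝ := (δ * p) ^ (1 / p) with hc
  have hc0 : 0 < c := by positivity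
  refine ⟨c⁻¹ ^ q / q, by have := hpq.pos; positivity, fun a b ha hb => ?_⟩
  have h1 := Real.young_inequality_of_nonneg (a := c⁻¹ * a) (b := c * b) (by positivity)
    (by positivity) hpq
  rw [Real.mul_rpow (by positivity) ha, Real.mul_rpow hc0.le hb] at h1
  have h2 : c ^ p = δ * p := by
    rw [hc, ← Real.rpow_mul (by positivity), one_div, inv_mul_cancel₀ hp0.ne', Real.rpow_one]
  have h3 : c⁻¹ * a * (c * b) = a * b := by field_simp
  rw [h2, h3] at h1
  calc a * b ≤ _ := h1
    _ = _ := by field_simp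

/-- Summability of products from conjugate exponents. -/
theorem summable_mul_of_young {V : Type*} {p : ℝ} (hp : 1 < p) {w A B f : V → ℝ}
    (hw : ∀ x, 0 ≤ w x) (hA : ∀ x, 0 ≤ A x) (hB : ∀ x, 0 ≤ B x)
    (hAs : Summable fun x => A x ^ (p / (p - 1)) * w x) (hBs : Summable fun x => B x ^ p * w x)
    (hf : ∀ x, |f x| ≤ A x * B x * w x) : Summable f := by
  obtain ⟨K, -, hK⟩ := exists_young hp one_pos
  refine Summable.of_norm_bounded ((hAs.mul_left K).add hBs) fun x => (hf x).trans ?_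
  have := mul_le_mul_of_nonneg_right (hK _ _ (hA x) (hB x)) (hw x)
  linarith

/-- Uniform smallness of the tails of products from conjugate exponents. -/
theorem tails_mul_of_young {ι V : Type*} {p C : ℝ} (hp : 1 < p) {w A : V → ℝ} {B f : ι → V → ℝ}
    (hw : ∀ x, 0 ≤ w x) (hA : ∀ x, 0 ≤ A x) (hB : ∀ i x, 0 ≤ B i x)
    (hAs : Summable fun x => A x ^ (p / (p - 1)) * w x)
    (hBs : ∀ i (T : Finset V), ∑ x ∈ T, B i x ^ p * w x ≤ C)
    (hf : ∀ i x, |f i x| ≤ A x * B i x * w x) {δ : ℝ} (hδ : 0 < δ) :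
    ∃ S : Finset V, ∀ i T, Disjoint T S → ∑ x ∈ T, |f i x| ≤ δ := by
  set η := δ / (2 * (|C| + 1)) with hη
  have hη0 : 0 < η := by positivity
  have hCη : η * C ≤ δ / 2 := by
    calc η * C ≤ η * (|C| + 1) := by gcongr; linarith [le_abs_self C]
      _ = δ / 2 := by rw [hη]; field_simp
  obtain ⟨K, hK0, hK⟩ := exists_young hp hη0
  obtain ⟨S, hS⟩ := exists_tail_le (hAs.mul_left K) (half_pos hδ)
  refine ⟨S, fun i T hT => ?_⟩
  calc ∑ x ∈ T, |f i x|
      ≤ ∑ x ∈ T, (K * (A x ^ (p / (p - 1)) * w x) + η * (B i x ^ p * w x)) := by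
        refine Finset.sum_le_sum fun x _ => (hf i x).trans ?_
        have := mul_le_mul_of_nonneg_right (hK _ _ (hA x) (hB i x)) (hw x)
        linarith
    _ = ∑ x ∈ T, K * (A x ^ (p / (p - 1)) * w x) + η * ∑ x ∈ T, B i x ^ p * w x := by
        rw [Finset.sum_add_distrib, Finset.mul_sum (f := fun x => B i x ^ p * w x)]
    _ ≤ δ / 2 + η * C := by
        have := hBs i T
        gcongr
        exact hS T hT
    _ ≤ δ := by linarith

/-! ### Pointwise calculus of the gradient -/

section Gradient

variable {V : Type*} (G : SimpleGraph V) [G.LocallyFinite]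

/-- The gradient at `x` as a Euclidean vector indexed by the neighbors of `x`. -/
noncomputable def gradVec (ω : V → V → ℝ) (μ : V → ℝ) (u : V → ℝ) (x : V) :
    EuclideanSpace ℝ (G.neighborFinset x) :=
  WithLp.toLp 2 fun y => √(ω x y / (2 * μ x)) * (u y - u x)

variable {G} {ω : V → V → ℝ} {μ : V → ℝ}

theorem gradVec_add (u v : V → ℝ) (x : V) :
    gradVec G ω μ (u + v) x = gradVec G ω μ u x + gradVec G ω μ v x := by
  ext y; simp [gradVec]; ring

theorem gradVec_sub (u v : V → ℝ) (x : V) :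
    gradVec G ω μ (u - v) x = gradVec G ω μ u x - gradVec G ω μ v x := by
  ext y; simp [gradVec]; ring

theorem gradVec_smul (t : ℝ) (u : V → ℝ) (x : V) :
    gradVec G ω μ (t • u) x = t • gradVec G ω μ u x := by
  ext y; simp [gradVec]; ring

theorem continuous_gradVec (x : V) : Continuous fun u => gradVec G ω μ u x := by
  unfold gradVec; fun_prop

theorem gradForm_eq_inner (hω : ∀ x y, G.Adj x y → 0 < ω x y) (hμ : ∀ x, 0 < μ x)
    (u v : V → ℝ) (x : V) :
    gradForm G ω μ u v x = inner ℝ (gradVec G ω μ u x) (gradVec G ω μ v x) := by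
  rw [PiLp.inner_apply, gradForm, Finset.mul_sum, ← Finset.sum_coe_sort]
  refine Finset.sum_congr rfl fun y _ => ?_
  have h1 : 0 ≤ ω x y / (2 * μ x) := by
    have := hω x y ((G.mem_neighborFinset x y).1 y.2)
    have := hμ x
    positivity
  have h2 := Real.mul_self_sqrt h1
  simp only [gradVec, RCLike.inner_apply, conj_trivial]
  calc 1 / (2 * μ x) * (ω x y * (u y - u x) * (v y - v x))
      = (ω x y / (2 * μ x)) * ((u y - u x) * (v y - v x)) := by ring
    _ = (√(ω x y / (2 * μ x)) * √(ω x y / (2 * μ x))) * ((u y - u x) * (v y - v x)) := by rw [h2]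
    _ = _ := by ring

theorem gradLen_eq_norm (hω : ∀ x y, G.Adj x y → 0 < ω x y) (hμ : ∀ x, 0 < μ x)
    (u : V → ℝ) (x : V) : gradLen G ω μ u x = ‖gradVec G ω μ u x‖ := by
  rw [gradLen, gradForm_eq_inner hω hμ, real_inner_self_eq_norm_sq, Real.sqrt_sq (norm_nonneg _)]

theorem gradLen_nonneg (u : V → ℝ) (x : V) : 0 ≤ gradLen G ω μ u x := Real.sqrt_nonneg _

theorem abs_gradForm_le (hω : ∀ x y, G.Adj x y → 0 < ω x y) (hμ : ∀ x, 0 < μ x)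
    (u v : V → ℝ) (x : V) :
    |gradForm G ω μ u v x| ≤ gradLen G ω μ u x * gradLen G ω μ v x := by
  rw [gradForm_eq_inner hω hμ, gradLen_eq_norm hω hμ, gradLen_eq_norm hω hμ]
  exact abs_real_inner_le_norm _ _

theorem gradLen_sub_le (hω : ∀ x y, G.Adj x y → 0 < ω x y) (hμ : ∀ x, 0 < μ x)
    (u v : V → ℝ) (x : V) :
    gradLen G ω μ (u - v) x ≤ gradLen G ω μ u x + gradLen G ω μ v x := by
  simp only [gradLen_eq_norm hω hμ, gradVec_sub]
  exact norm_sub_le _ _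

theorem continuous_gradForm_right (u : V → ℝ) (x : V) :
    Continuous fun v => gradForm G ω μ u v x := by
  unfold gradForm; fun_prop

theorem continuous_gradLen (x : V) : Continuous fun u => gradLen G ω μ u x := by
  unfold gradLen gradForm; fun_prop

/-- For p < 2 the first factor alone is singular where the gradient vanishes. The product is p⁻¹
times the derivative of ‖·‖^p, which is C¹ for p > 1, paired with a fixed vector. -/
theorem continuous_flux (hω : ∀ x y, G.Adj x y → 0 < ω x y) (hμ : ∀ x, 0 < μ x) {p : ℝ}
    (hp : 1 < p) (v : V → ℝ) (x : V) :
    Continuous fun u => gradLen G ω μ u x ^ (p - 2) * gradForm G ω μ u v x := by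
  have h1 := (contDiff_norm_rpow (E := EuclideanSpace ℝ (G.neighborFinset x)) hp).continuous_fderiv
    one_ne_zero
  have h2 : Continuous fun u => p⁻¹ * (fderiv ℝ (fun w : EuclideanSpace ℝ (G.neighborFinset x) =>
      ‖w‖ ^ p) (gradVec G ω μ u x)) (gradVec G ω μ v x) :=
    continuous_const.mul ((h1.comp (continuous_gradVec x)).clm_apply continuous_const)
  convert h2 using 2 with u
  rw [fderiv_norm_rpow _ hp, gradLen_eq_norm hω hμ, gradForm_eq_inner hω hμ]
  simp only [smul_apply, innerSL_apply_apply, smul_eq_mul]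
  field_simp

theorem hasDerivAt_gradLen_rpow (hω : ∀ x y, G.Adj x y → 0 < ω x y) (hμ : ∀ x, 0 < μ x) {p : ℝ}
    (hp : 1 < p) (u v : V → ℝ) (x : V) :
    HasDerivAt (fun t : ℝ => gradLen G ω μ (u + t • v) x ^ p)
      (p * (gradLen G ω μ u x ^ (p - 2) * gradForm G ω μ u v x)) 0 := by
  have h1 : HasDerivAt (fun t : ℝ => gradVec G ω μ u x + t • gradVec G ω μ v x)
      (gradVec G ω μ v x) 0 := by
    simpa using ((hasDerivAt_id (0 : ℝ)).smul_const (gradVec G ω μ v x)).const_add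
      (gradVec G ω μ u x)
  have h2 := (hasFDerivAt_norm_rpow (gradVec G ω μ u x + (0 : ℝ) • gradVec G ω μ v x)
    hp).comp_hasDerivAt (0 : ℝ) h1
  simp only [gradLen_eq_norm hω hμ, gradForm_eq_inner hω hμ, gradVec_add, gradVec_smul]
  refine h2.congr_deriv ?_
  simp [mul_assoc]

theorem abs_flux_le (hω : ∀ x y, G.Adj x y → 0 < ω x y) (hμ : ∀ x, 0 < μ x) (p : ℝ)
    (u v : V → ℝ) (x : V) :
    |gradLen G ω μ u x ^ (p - 2) * gradForm G ω μ u v x| ≤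
      gradLen G ω μ u x ^ (p - 1) * gradLen G ω μ v x := by
  have h0 := gradLen_nonneg (G := G) (ω := ω) (μ := μ) u x
  have h1 := abs_gradForm_le hω hμ u v x
  rw [abs_mul, abs_of_nonneg (Real.rpow_nonneg h0 _)]
  -- Where the gradient vanishes, Cauchy–Schwarz kills the gradient form too, so the value of
  -- 0^(p-2) is irrelevant.
  rcases h0.eq_or_lt with h | h
  · rw [← h, zero_mul] at h1
    rw [le_antisymm h1 (abs_nonneg _), mul_zero, ← h]
    exact mul_nonneg (Real.rpow_nonneg le_rfl _) (gradLen_nonneg _ _)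
  · calc _ ≤ gradLen G ω μ u x ^ (p - 2) * (gradLen G ω μ u x * gradLen G ω μ v x) := by gcongr
      _ = gradLen G ω μ u x ^ (p - 2 + 1) * gradLen G ω μ v x := by
        rw [Real.rpow_add_one h.ne']; ring
      _ = _ := by ring_nf

theorem abs_rpow_sub_two_mul {p : ℝ} (hp : 1 < p) (s : ℝ) :
    |(|s| ^ (p - 2) * s)| = |s| ^ (p - 1) := by
  rcases eq_or_ne s 0 with rfl | hs
  · simp [Real.zero_rpow (by linarith : p - 1 ≠ 0)]
  · rw [abs_mul, abs_of_nonneg (Real.rpow_nonneg (abs_nonneg s) _),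
      ← Real.rpow_add_one (abs_ne_zero.2 hs)]
    ring_nf

theorem rpow_sub_two_mul_sq {p s : ℝ} (hp : 1 < p) (hs : 0 ≤ s) :
    s ^ (p - 2) * s ^ 2 = s ^ p := by
  rcases hs.eq_or_lt with rfl | h
  · simp [Real.zero_rpow (by linarith : p ≠ 0)]
  · rw [← Real.rpow_natCast, ← Real.rpow_add h]; norm_num

theorem flux_self (hω : ∀ x y, G.Adj x y → 0 < ω x y) (hμ : ∀ x, 0 < μ x) {p : ℝ}
    (hp : 1 < p) (u : V → ℝ) (x : V) :
    gradLen G ω μ u x ^ (p - 2) * gradForm G ω μ u u x = gradLen G ω μ u x ^ p := by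
  rw [← rpow_sub_two_mul_sq hp (gradLen_nonneg u x), gradForm_eq_inner hω hμ,
    gradLen_eq_norm hω hμ, real_inner_self_eq_norm_sq]

theorem gradForm_eq_zero {φ : V → ℝ} {x : V} (hx : φ x = 0) (hn : ∀ y, G.Adj x y → φ y = 0)
    (u : V → ℝ) : gradForm G ω μ u φ x = 0 := by
  rw [gradForm, Finset.sum_eq_zero, mul_zero]
  intro y hy
  rw [hn y ((G.mem_neighborFinset x y).1 hy), hx, sub_zero, mul_zero]

/-- If the increments of `w` are dominated by those of `u` or `v`, so is the gradient. -/
theorem gradLen_le_add (hω : ∀ x y, G.Adj x y → 0 < ω x y) (hμ : ∀ x, 0 < μ x)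
    {u v w : V → ℝ} (hw : ∀ x y, |w y - w x| ≤ max |u y - u x| |v y - v x|) (x : V) :
    gradLen G ω μ w x ≤ gradLen G ω μ u x + gradLen G ω μ v x := by
  have h1 : gradForm G ω μ w w x ≤ gradForm G ω μ u u x + gradForm G ω μ v v x := by
    unfold gradForm
    rw [← mul_add, ← Finset.sum_add_distrib]
    have := hμ x
    refine mul_le_mul_of_nonneg_left (Finset.sum_le_sum fun y hy => ?_) (by positivity)
    have hxy := hω x y ((G.mem_neighborFinset x y).1 hy)
    have h2 : (w y - w x) ^ 2 ≤ (u y - u x) ^ 2 + (v y - v x) ^ 2 := by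
      rcases le_max_iff.1 (hw x y) with h | h <;> have := sq_le_sq.2 h <;>
        nlinarith [sq_nonneg (u y - u x), sq_nonneg (v y - v x)]
    calc ω x y * (w y - w x) * (w y - w x) = ω x y * (w y - w x) ^ 2 := by ring
      _ ≤ ω x y * ((u y - u x) ^ 2 + (v y - v x) ^ 2) := by gcongr
      _ = _ := by ring
  have hu : 0 ≤ gradForm G ω μ u u x := by
    rw [gradForm_eq_inner hω hμ]; exact real_inner_self_nonneg
  have hv : 0 ≤ gradForm G ω μ v v x := by
    rw [gradForm_eq_inner hω hμ]; exact real_inner_self_nonneg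
  unfold gradLen
  refine Real.sqrt_le_iff.2 ⟨by positivity, ?_⟩
  nlinarith [Real.sq_sqrt hu, Real.sq_sqrt hv,
    mul_nonneg (Real.sqrt_nonneg (gradForm G ω μ u u x)) (Real.sqrt_nonneg (gradForm G ω μ v v x))]

variable (G) in
/-- A finite set of vertices together with all neighbors. -/
noncomputable def closedNhd (S : Finset V) : Finset V := by
  classical exact S ∪ S.biUnion fun x => G.neighborFinset x

theorem subset_closedNhd (S : Finset V) : S ⊆ closedNhd G S := by
  classical exact Finset.subset_union_left

theorem not_mem_of_not_mem_closedNhd {S : Finset V} {x y : V} (hx : x ∉ closedNhd G S)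
    (hxy : G.Adj x y) : y ∉ S := by
  classical
  intro hy
  refine hx (Finset.mem_union_right _ (Finset.mem_biUnion.2 ⟨y, hy, ?_⟩))
  simpa using hxy.symm

theorem gradForm_eq_zero_of_not_mem {S : Finset V} {φ : V → ℝ} (hφ : ∀ x ∉ S, φ x = 0) {x : V}
    (hx : x ∉ closedNhd G S) (u : V → ℝ) : gradForm G ω μ u φ x = 0 :=
  gradForm_eq_zero (hφ x fun h => hx (subset_closedNhd S h))
    (fun _ hxy => hφ _ (not_mem_of_not_mem_closedNhd hx hxy)) u

/-- Testing the weak form of the `p`-Laplacian with the indicator of a vertex. -/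
theorem sum_flux_single [DecidableEq V] (hω_symm : ∀ x y, ω x y = ω y x) (hμ : ∀ x, 0 < μ x)
    (p : ℝ) (u : V → ℝ) (z : V) :
    ∑ x ∈ closedNhd G {z},
      gradLen G ω μ u x ^ (p - 2) * gradForm G ω μ u (Pi.single z 1) x * μ x =
      -pLaplacian G ω μ p u z * μ z := by
  have h1 : closedNhd G {z} = insert z (G.neighborFinset z) := by
    ext; simp [closedNhd]
  have hz := (hμ z).ne'
  rw [h1, Finset.sum_insert (by simp)]
  have h2 : gradForm G ω μ u (Pi.single z 1) z * μ z =
      -(1 / 2) * ∑ y ∈ G.neighborFinset z, ω z y * (u y - u z) := by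
    have : ∑ y ∈ G.neighborFinset z, ω z y * (u y - u z) *
        ((Pi.single z 1 : V → ℝ) y - (Pi.single z 1 : V → ℝ) z) =
        - ∑ y ∈ G.neighborFinset z, ω z y * (u y - u z) := by
      rw [← Finset.sum_neg_distrib]
      refine Finset.sum_congr rfl fun y hy => ?_
      have : y ≠ z := ((G.mem_neighborFinset z y).1 hy).ne'
      simp [this]
    rw [gradForm, this]
    field_simp
  -- At a neighbor only the edge back to `z` contributes; together with the term at `z` this
  -- produces the symmetrized coefficient |∇u|^(p-2)(x) + |∇u|^(p-2)(z).
  have h3 : ∀ x ∈ G.neighborFinset z, gradForm G ω μ u (Pi.single z 1) x * μ x =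
      -(1 / 2) * (ω z x * (u x - u z)) := by
    intro x hx
    have hxz := (G.mem_neighborFinset z x).1 hx
    have hμx := (hμ x).ne'
    rw [gradForm, Finset.sum_eq_single z]
    · have : x ≠ z := hxz.ne'
      simp only [Pi.single_eq_same, Pi.single_eq_of_ne this, sub_zero, mul_one, hω_symm x z]
      field_simp
      ring
    · intro y _ hy
      have : x ≠ z := hxz.ne'
      simp [hy, this]
    · intro h
      exact absurd ((G.mem_neighborFinset x z).2 hxz.symm) h
  have h4 : ∑ x ∈ G.neighborFinset z,
      gradLen G ω μ u x ^ (p - 2) * gradForm G ω μ u (Pi.single z 1) x * μ x =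
      ∑ x ∈ G.neighborFinset z,
        gradLen G ω μ u x ^ (p - 2) * (-(1 / 2) * (ω z x * (u x - u z))) :=
    Finset.sum_congr rfl fun x hx => by rw [mul_assoc, h3 x hx]
  rw [mul_assoc, h2, h4]
  rw [pLaplacian, Finset.mul_sum, Finset.mul_sum, ← Finset.sum_add_distrib, Finset.mul_sum,
    neg_mul, Finset.sum_mul, ← Finset.sum_neg_distrib]
  refine Finset.sum_congr rfl fun x _ => ?_
  field_simp
  ring

end Gradient

/-! ### Coercivity and minimization on finite sets -/

section Minimizer

/-- The difference of the two sides vanishes at 0 and has nonnegative derivative on the half-line.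
The one-sided hypothesis lets negative arguments be treated by reflection. -/
theorem le_potential_of_deriv_le {p c g : ℝ} (hp : 1 < p) {F F' : ℝ → ℝ}
    (hF : ∀ s, HasDerivAt F (F' s) s) (hF0 : F 0 = 0)
    (hle : ∀ s, 0 ≤ s → F' s ≤ c * |s| ^ (p - 1) + g) {s : ℝ} (hs : 0 ≤ s) :
    F s ≤ c / p * |s| ^ p + g * |s| := by
  have hd : ∀ t, HasDerivAt (fun t => c / p * |t| ^ p + g * t - F t)
      (c / p * (p * |t| ^ (p - 2) * t) + g * 1 - F' t) t := fun t =>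
    (((hasDerivAt_abs_rpow t hp).const_mul _).add ((hasDerivAt_id t).const_mul g)).sub (hF t)
  have hmono : MonotoneOn (fun t => c / p * |t| ^ p + g * t - F t) (Set.Ici 0) := by
    refine monotoneOn_of_deriv_nonneg (convex_Ici 0)
      (fun t _ => (hd t).continuousAt.continuousWithinAt)
      (fun t _ => (hd t).differentiableAt.differentiableWithinAt) fun t ht => ?_
    rw [interior_Ici, Set.mem_Ioi] at ht
    rw [(hd t).deriv]
    have h1 := hle t ht.le
    have h2 : |t| ^ (p - 1) = |t| ^ (p - 2) * t := by
      rw [abs_of_pos ht, ← Real.rpow_add_one ht.ne']; ring_nf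
    rw [h2] at h1
    have h3 : c / p * (p * |t| ^ (p - 2) * t) = c * (|t| ^ (p - 2) * t) := by
      field_simp
    linarith
  have := hmono (Set.mem_Ici.2 le_rfl) (Set.mem_Ici.2 hs) hs
  have hp0 : p ≠ 0 := by linarith
  simp only [abs_zero, Real.zero_rpow hp0, hF0, mul_zero, add_zero, sub_zero] at this
  rw [abs_of_nonneg hs] at *
  linarith

/-- A bound on the derivative integrates to a bound on the potential. -/
theorem potential_le {p c g : ℝ} (hp : 1 < p) {F F' : ℝ → ℝ}
    (hF : ∀ s, HasDerivAt F (F' s) s) (hF0 : F 0 = 0)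
    (hle : ∀ s, |F' s| ≤ c * |s| ^ (p - 1) + g) (s : ℝ) :
    F s ≤ c / p * |s| ^ p + g * |s| := by
  rcases le_total 0 s with hs | hs
  · exact le_potential_of_deriv_le hp hF hF0 (fun t _ => (le_abs_self _).trans (hle t)) hs
  · have h1 : ∀ t, HasDerivAt (fun t => F (-t)) (F' (-t) * -1) t := fun t =>
      (hF (-t)).comp t (hasDerivAt_neg t)
    have := le_potential_of_deriv_le (c := c) (g := g) hp h1 (by simpa using hF0)
      (fun t _ => ?_) (neg_nonneg.2 hs)
    · simpa using this
    · have h2 := hle (-t)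
      rw [abs_neg] at h2
      have := neg_abs_le (F' (-t))
      linarith

variable {V : Type*} (G : SimpleGraph V) [G.LocallyFinite]

/-- The density `(|∇u|^p + h |u|^p) μ` of the energy. -/
noncomputable def energyDensity (ω : V → V → ℝ) (μ : V → ℝ) (p : ℝ) (h u : V → ℝ) (x : V) : ℝ :=
  (gradLen G ω μ u x ^ p + h x * |u x| ^ p) * μ x

/-- The integrand of the weak form of the operator `-Δ_p u + h |u|^{p-2} u`. -/
noncomputable def weakIntegrand (ω : V → V → ℝ) (μ : V → ℝ) (p : ℝ) (h u φ : V → ℝ) (x : V) : ℝ :=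
  gradLen G ω μ u x ^ (p - 2) * gradForm G ω μ u φ x + h x * |u x| ^ (p - 2) * u x * φ x

variable {G} {ω : V → V → ℝ} {μ : V → ℝ} {p : ℝ} {h : V → ℝ}

theorem energyDensity_nonneg (hμ : ∀ x, 0 < μ x) (hh : ∀ x, 0 ≤ h x) (u : V → ℝ) (x : V) :
    0 ≤ energyDensity G ω μ p h u x := by
  have h1 := gradLen_nonneg (G := G) (ω := ω) (μ := μ) u x
  have := hμ x
  have := hh x
  unfold energyDensity
  positivity

theorem continuous_energyDensity (hp : 1 < p) (x : V) :
    Continuous fun u => energyDensity G ω μ p h u x := by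
  unfold energyDensity
  have h1 : Continuous fun u => gradLen G ω μ u x ^ p :=
    (continuous_gradLen x).rpow_const fun _ => Or.inr (by linarith)
  have h2 : Continuous fun u : V → ℝ => |u x| ^ p :=
    (continuous_apply x).abs.rpow_const fun _ => Or.inr (by linarith)
  fun_prop

theorem energyDensity_eq_zero (hp : 1 < p) {S : Finset V} {u : V → ℝ} (hu : ∀ x ∉ S, u x = 0)
    {x : V} (hx : x ∉ closedNhd G S) : energyDensity G ω μ p h u x = 0 := by
  have hp0 : p ≠ 0 := by linarith
  rw [energyDensity, gradLen, gradForm_eq_zero_of_not_mem hu hx,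
    hu x fun hS => hx (subset_closedNhd S hS)]
  simp [Real.zero_rpow hp0]

theorem energyDensity_zero (hp : 1 < p) (x : V) : energyDensity G ω μ p h 0 x = 0 := by
  have hp0 : p ≠ 0 := by linarith
  simp [energyDensity, gradLen, gradForm, Real.zero_rpow hp0]

theorem weakIntegrand_self (hω : ∀ x y, G.Adj x y → 0 < ω x y) (hμ : ∀ x, 0 < μ x)
    (hp : 1 < p) (u : V → ℝ) (x : V) :
    weakIntegrand G ω μ p h u u x * μ x = energyDensity G ω μ p h u x := by
  rw [weakIntegrand, flux_self hω hμ hp, energyDensity, ← rpow_sub_two_mul_sq hp (abs_nonneg (u x)),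
    sq_abs]
  ring

/-- A single term of the energy controls the value at its vertex, because h and μ are bounded below.
This supplies the compact boxes used for minimization and for the limit. -/
theorem abs_le_of_energyDensity_le {h₀ μ₀ C : ℝ} (hp : 1 < p) (hh₀ : 0 < h₀)
    (hh : ∀ x, h₀ ≤ h x) (hμ₀ : 0 < μ₀) (hμ : ∀ x, μ₀ ≤ μ x) {u : V → ℝ} {x : V}
    (hu : energyDensity G ω μ p h u x ≤ C) : |u x| ≤ (C / (h₀ * μ₀)) ^ (1 / p) := by
  have hp0 : 0 < p := by linarith
  have h1 : h₀ * |u x| ^ p * μ₀ ≤ C := by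
    refine le_trans ?_ hu
    have := Real.rpow_nonneg (gradLen_nonneg (G := G) (ω := ω) (μ := μ) u x) p
    have h2 : h₀ * |u x| ^ p ≤ h x * |u x| ^ p := by gcongr; exact hh x
    have h3 : 0 ≤ h₀ * |u x| ^ p := by positivity
    exact mul_le_mul (by linarith) (hμ x) hμ₀.le (by linarith)
  have h2 : |u x| ^ p ≤ C / (h₀ * μ₀) := by
    rw [le_div_iff₀ (by positivity)]; linarith
  calc |u x| = (|u x| ^ p) ^ (1 / p) := by
        rw [← Real.rpow_mul (abs_nonneg _), mul_one_div_cancel hp0.ne', Real.rpow_one]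
    _ ≤ _ := by gcongr

/-- Coercivity of the density of the variational functional. -/
theorem exists_coercive {M h₀ : ℝ} (hp : 1 < p) (hM₀ : 0 ≤ M) (hM : M < h₀) :
    ∃ c > 0, ∃ K ≥ 0, ∀ (a s h g Φ : ℝ), 0 ≤ a → 0 ≤ s → 0 ≤ g → h₀ ≤ h →
      Φ ≤ M / p * s ^ p + g * s →
      c * (a + h * s ^ p) ≤ K * g ^ (p / (p - 1)) + ((a + h * s ^ p) / p - Φ) := by
  have hp0 : 0 < p := by linarith
  have hh₀ : 0 < h₀ := by linarith
  -- The growth term uses the share 1 - θ of the potential energy. Of the remaining share θ, half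
  -- absorbs the Young term from g s, and half survives as the coercivity constant θ/(2p).
  set θ := 1 - M / h₀ with hθ
  have hθ0 : 0 < θ := by rw [hθ, sub_pos, div_lt_one hh₀]; exact hM
  have hθ1 : θ ≤ 1 := by rw [hθ]; have : 0 ≤ M / h₀ := by positivity
                         linarith
  obtain ⟨K, hK0, hK⟩ := exists_young hp (show 0 < θ * h₀ / (2 * p) by positivity)
  refine ⟨θ / (2 * p), by positivity, K, hK0, fun a s h g Φ ha hs hg hh hΦ => ?_⟩
  have h1 := hK g s hg hs
  have hsp := Real.rpow_nonneg hs p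
  set P := s ^ p
  set Q := g ^ (p / (p - 1))
  have h2 : M ≤ (1 - θ) * h := by
    have : M = (1 - θ) * h₀ := by rw [hθ, sub_sub_cancel, div_mul_cancel₀ _ hh₀.ne']
    calc M = (1 - θ) * h₀ := this
      _ ≤ _ := by gcongr
  have h3 : M / p * P ≤ (1 - θ) * h / p * P := by gcongr
  have h4 : θ * h₀ / (2 * p) * P ≤ θ * h / (2 * p) * P := by gcongr
  have h5 : θ / (2 * p) * a ≤ a / p := by
    rw [div_mul_eq_mul_div, div_le_div_iff₀ (by positivity) hp0]
    nlinarith [mul_nonneg ha hp0.le, mul_nonneg (mul_nonneg ha hp0.le) (sub_nonneg.2 hθ1)]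
  have h6 : θ / (2 * p) * (a + h * P) = θ / (2 * p) * a + θ * h / (2 * p) * P := by ring
  have h7 : (a + h * P) / p = a / p + (1 - θ) * h / p * P + θ * h / (2 * p) * P
      + θ * h / (2 * p) * P := by field_simp; ring
  rw [h6, h7]
  linarith

/-- On every finite set there is a solution of the truncated problem, with energy bounded
independently of the set. -/
theorem exists_solution_on_finset {h₀ μ₀ M : ℝ} {g : V → ℝ} {f Φ : V → ℝ → ℝ}
    (hω : ∀ x y, G.Adj x y → 0 < ω x y)
    (hμ₀ : 0 < μ₀) (hμ : ∀ x, μ₀ ≤ μ x) (hp : 1 < p) (hh : ∀ x, h₀ ≤ h x)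
    (hM₀ : 0 ≤ M) (hM : M < h₀) (hg₀ : ∀ x, 0 ≤ g x)
    (hg : Summable fun x => g x ^ (p / (p - 1)) * μ x)
    (hΦ : ∀ x s, HasDerivAt (Φ x) (f x s) s) (hΦ₀ : ∀ x, Φ x 0 = 0)
    (hf : ∀ x s, |f x s| ≤ M * |s| ^ (p - 1) + g x) :
    ∃ C ≥ 0, ∀ S : Finset V, ∃ v : V → ℝ, (∀ x ∉ S, v x = 0) ∧
      (∀ T : Finset V, ∑ x ∈ T, energyDensity G ω μ p h v x ≤ C) ∧
      ∀ φ : V → ℝ, (∀ x ∉ S, φ x = 0) →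
        ∑' x, weakIntegrand G ω μ p h v φ x * μ x = ∑' x, f x (v x) * φ x * μ x := by
  classical
  have hp0 : 0 < p := by linarith
  have hh₀ : 0 < h₀ := by linarith
  have hμp : ∀ x, 0 < μ x := fun x => hμ₀.trans_le (hμ x)
  have hhp : ∀ x, 0 ≤ h x := fun x => hh₀.le.trans (hh x)
  obtain ⟨c, hc, K, hK, hcoer⟩ := exists_coercive hp hM₀ hM
  set C := K * (∑' x, g x ^ (p / (p - 1)) * μ x) / c with hC
  have hgq : ∀ x, 0 ≤ g x ^ (p / (p - 1)) * μ x := fun x =>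
    mul_nonneg (Real.rpow_nonneg (hg₀ x) _) (hμp x).le
  have hC0 : 0 ≤ C := div_nonneg (mul_nonneg hK (tsum_nonneg hgq)) hc.le
  refine ⟨C, hC0, fun S => ?_⟩
  -- For functions supported in `S`, energy and potential vanish outside the closed neighborhood, so
  -- summing over `N` gives the full functional.
  set N := closedNhd G S
  let j : V → (V → ℝ) → ℝ := fun x u => energyDensity G ω μ p h u x / p - Φ x (u x) * μ x
  let J : (V → ℝ) → ℝ := fun u => ∑ x ∈ N, j x u
  have hbound : ∀ u, J u ≤ 0 → ∑ x ∈ N, energyDensity G ω μ p h u x ≤ C := by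
    intro u hu
    rw [hC, le_div_iff₀ hc, mul_comm]
    calc c * ∑ x ∈ N, energyDensity G ω μ p h u x
        = ∑ x ∈ N, c * energyDensity G ω μ p h u x := Finset.mul_sum _ _ _
      _ ≤ ∑ x ∈ N, (K * (g x ^ (p / (p - 1)) * μ x) + j x u) := by
        refine Finset.sum_le_sum fun x _ => ?_
        have h1 := hcoer (gradLen G ω μ u x ^ p) |u x| (h x) (g x) (Φ x (u x))
          (Real.rpow_nonneg (gradLen_nonneg _ _) _) (abs_nonneg _) (hg₀ x) (hh x)
          (potential_le hp (hΦ x) (hΦ₀ x) (hf x) (u x))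
        have h2 := mul_le_mul_of_nonneg_right h1 (hμp x).le
        simp only [j, energyDensity]
        calc _ = _ := by ring
          _ ≤ _ := h2
          _ = _ := by ring
      _ = K * (∑ x ∈ N, g x ^ (p / (p - 1)) * μ x) + J u := by
        rw [Finset.sum_add_distrib, Finset.mul_sum]
      _ ≤ K * (∑' x, g x ^ (p / (p - 1)) * μ x) + 0 := by
        gcongr
        exact hg.sum_le_tsum _ fun x _ => hgq x
      _ = _ := add_zero _
  set R := (C / (h₀ * μ₀)) ^ (1 / p) with hR
  have hR0 : 0 ≤ R := by positivity
  -- Coordinates outside `S` are pinned to 0; `R` is the pointwise bound that energy at most `C`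
  -- imposes.
  let B : Set (V → ℝ) := Set.pi Set.univ fun x => if x ∈ S then Set.Icc (-R) R else {0}
  have hBc : IsCompact B := by
    refine isCompact_univ_pi fun x => ?_
    split_ifs
    exacts [isCompact_Icc, isCompact_singleton]
  have h0B : (0 : V → ℝ) ∈ B := by
    intro x _
    by_cases hx : x ∈ S <;> simp [hx, hR0]
  have hJc : Continuous J := by
    refine continuous_finsetSum _ fun x _ => ?_
    have h1 : Continuous (Φ x) :=
      continuous_iff_continuousAt.2 fun s => (hΦ x s).continuousAt
    exact ((continuous_energyDensity hp x).div_const p).sub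
      ((h1.comp (continuous_apply x)).mul_const _)
  have hJ0 : J 0 = 0 := by
    refine Finset.sum_eq_zero fun x _ => ?_
    simp [j, energyDensity_zero hp, hΦ₀]
  obtain ⟨v, hvB, hvmin⟩ := hBc.exists_isMinOn ⟨0, h0B⟩ hJc.continuousOn
  have hvS : ∀ x ∉ S, v x = 0 := by
    intro x hx
    have := hvB x (Set.mem_univ x)
    simpa [hx] using this
  have hJv : J v ≤ 0 := hJ0 ▸ hvmin h0B
  -- The minimum over the box is global among functions supported in `S`: a competitor with J ≤ 0
  -- has energy at most `C` and lies in the box, and any other has J ≥ 0 ≥ J(v).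
  have hmin : ∀ w : V → ℝ, (∀ x ∉ S, w x = 0) → J v ≤ J w := by
    intro w hw
    rcases le_total (J w) 0 with hJw | hJw
    · refine hvmin ?_
      intro x _
      by_cases hx : x ∈ S
      · have h1 : energyDensity G ω μ p h w x ≤ C :=
          (Finset.single_le_sum (fun y _ => energyDensity_nonneg hμp hhp w y)
            (subset_closedNhd S hx)).trans (hbound w hJw)
        have h2 : |w x| ≤ R := abs_le_of_energyDensity_le hp hh₀ hh hμ₀ hμ h1
        simpa [hx] using abs_le.1 h2
      · simp [hx, hw x hx]
    · exact hJv.trans hJw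
  refine ⟨v, hvS, fun T => ?_, fun φ hφ => ?_⟩
  · calc ∑ x ∈ T, energyDensity G ω μ p h v x
        ≤ ∑ x ∈ T ∪ N, energyDensity G ω μ p h v x :=
          Finset.sum_le_sum_of_subset_of_nonneg Finset.subset_union_left
            fun x _ _ => energyDensity_nonneg hμp hhp v x
      _ = ∑ x ∈ N, energyDensity G ω μ p h v x :=
          (Finset.sum_subset Finset.subset_union_right
            fun x _ hx => energyDensity_eq_zero hp hvS hx).symm
      _ ≤ C := hbound v hJv
  · have hd : HasDerivAt (fun t : ℝ => J (v + t • φ))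
        (∑ x ∈ N, (weakIntegrand G ω μ p h v φ x * μ x - f x (v x) * φ x * μ x)) 0 := by
      refine HasDerivAt.fun_sum fun x _ => ?_
      have h1 := hasDerivAt_gradLen_rpow hω hμp hp v φ x
      have h2 : HasDerivAt (fun t : ℝ => (v + t • φ) x) (φ x) 0 := by
        simpa using ((hasDerivAt_id (0 : ℝ)).mul_const (φ x)).const_add (v x)
      have h3 : HasDerivAt (fun t : ℝ => |(v + t • φ) x| ^ p)
          (p * |v x| ^ (p - 2) * v x * φ x) 0 := by
        have := (hasDerivAt_abs_rpow ((v + (0 : ℝ) • φ) x) hp).comp (0 : ℝ) h2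
        simpa [Function.comp_def] using this
      have h4 : HasDerivAt (fun t : ℝ => Φ x ((v + t • φ) x)) (f x (v x) * φ x) 0 := by
        have := (hΦ x ((v + (0 : ℝ) • φ) x)).comp (0 : ℝ) h2
        simpa [Function.comp_def] using this
      have h5 := (((h1.add (h3.const_mul (h x))).mul_const (μ x)).div_const p).sub
        (h4.mul_const (μ x))
      refine h5.congr_deriv ?_
      rw [weakIntegrand]
      field_simp
    have hloc : IsLocalMin (fun t : ℝ => J (v + t • φ)) 0 := by
      refine Eventually.of_forall fun t => ?_
      simp only [zero_smul, add_zero]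
      exact hmin _ fun x hx => by simp [hvS x hx, hφ x hx]
    have h0 := hloc.hasDerivAt_eq_zero hd
    rw [Finset.sum_sub_distrib, sub_eq_zero] at h0
    rw [tsum_eq_sum (s := N), tsum_eq_sum (s := N), h0]
    · intro x hx
      rw [hφ x fun hS => hx (subset_closedNhd S hS)]; simp
    · intro x hx
      rw [weakIntegrand, gradForm_eq_zero_of_not_mem hφ hx,
        hφ x fun hS => hx (subset_closedNhd S hS)]; simp

end Minimizer

/-! ### Passing to the limit in the pairings -/

section Limit

/-- One factor is fixed in the dual space and the other merely bounded in L^p; Young's inequality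
makes the tails uniformly small, so pointwise convergence suffices. -/
theorem tendsto_tsum_of_young {ι V : Type*} {l : Filter ι} [l.NeBot] {p C : ℝ} (hp : 1 < p)
    {w A : V → ℝ} {B f : ι → V → ℝ} {f₀ : V → ℝ}
    (hw : ∀ x, 0 ≤ w x) (hA : ∀ x, 0 ≤ A x) (hB : ∀ i x, 0 ≤ B i x)
    (hAs : Summable fun x => A x ^ (p / (p - 1)) * w x)
    (hBs : ∀ i (T : Finset V), ∑ x ∈ T, B i x ^ p * w x ≤ C)
    (hf : ∀ i x, |f i x| ≤ A x * B i x * w x)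
    (hlim : ∀ x, Tendsto (fun i => f i x) l (𝓝 (f₀ x))) :
    (∀ i, Summable (f i)) ∧ Summable f₀ ∧ Tendsto (fun i => ∑' x, f i x) l (𝓝 (∑' x, f₀ x)) := by
  have h1 : ∀ i, Summable (f i) := fun i =>
    summable_mul_of_young hp hw hA (hB i) hAs
      (summable_of_sum_le (fun x => mul_nonneg (Real.rpow_nonneg (hB i x) p) (hw x)) (hBs i)) (hf i)
  refine ⟨h1, tendsto_tsum_of_tails h1 hlim fun δ hδ => ?_⟩
  obtain ⟨S, hS⟩ := tails_mul_of_young hp hw hA hB hAs hBs hf hδ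
  exact ⟨S, Eventually.of_forall hS⟩

theorem rpow_sub_one_rpow {p a : ℝ} (hp : 1 < p) (ha : 0 ≤ a) :
    (a ^ (p - 1)) ^ (p / (p - 1)) = a ^ p := by
  rw [← Real.rpow_mul ha, mul_div_cancel₀ _ (by linarith : p - 1 ≠ 0)]

variable {V : Type*} {G : SimpleGraph V} [G.LocallyFinite] {ω : V → V → ℝ} {μ : V → ℝ} {p : ℝ}
  {h : V → ℝ}

theorem gradLen_rpow_mul_le (hμ : ∀ x, 0 < μ x) (hh : ∀ x, 0 ≤ h x) (u : V → ℝ) (x : V) :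
    gradLen G ω μ u x ^ p * μ x ≤ energyDensity G ω μ p h u x := by
  have := hμ x
  have := hh x
  unfold energyDensity
  gcongr
  have : 0 ≤ h x * |u x| ^ p := by positivity
  linarith

theorem abs_rpow_mul_le (hμ : ∀ x, 0 < μ x) (u : V → ℝ) (x : V) :
    |u x| ^ p * (h x * μ x) ≤ energyDensity G ω μ p h u x := by
  have := hμ x
  have h1 := Real.rpow_nonneg (gradLen_nonneg (G := G) (ω := ω) (μ := μ) u x) p
  calc |u x| ^ p * (h x * μ x) = (h x * |u x| ^ p) * μ x := by ring
    _ ≤ _ := by unfold energyDensity; gcongr; linarith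

theorem abs_rpow_mul_le_div {h₀ : ℝ} (hμ : ∀ x, 0 < μ x) (hh₀ : 0 < h₀)
    (u : V → ℝ) {x : V} (hx : h₀ ≤ h x) :
    |u x| ^ p * μ x ≤ energyDensity G ω μ p h u x / h₀ := by
  rw [le_div_iff₀ hh₀]
  refine le_trans ?_ (abs_rpow_mul_le (p := p) (h := h) hμ u x)
  have := hμ x
  have h1 := Real.rpow_nonneg (abs_nonneg (u x)) p
  calc |u x| ^ p * μ x * h₀ = |u x| ^ p * (h₀ * μ x) := by ring
    _ ≤ _ := by gcongr

/-- Gives the domination that turns convergence of the weighted energies into convergence in the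
unweighted Sobolev norm, whose density is the case of potential 1. -/
theorem energyDensity_sub_le {h₀ : ℝ} (hω : ∀ x y, G.Adj x y → 0 < ω x y) (hμ : ∀ x, 0 < μ x)
    (hp : 1 < p) (hh₀ : 0 < h₀) (hh : ∀ x, h₀ ≤ h x) (u v : V → ℝ) (x : V) :
    energyDensity G ω μ p (fun _ => 1) (u - v) x ≤
      2 ^ p * (1 + 1 / h₀) * (energyDensity G ω μ p h v x + energyDensity G ω μ p h u x) := by
  have hp0 : 0 ≤ p := by linarith
  have hhp : ∀ x, 0 ≤ h x := fun x => hh₀.le.trans (hh x)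
  have hμx := hμ x
  have gu := gradLen_nonneg (G := G) (ω := ω) (μ := μ) u x
  have gv := gradLen_nonneg (G := G) (ω := ω) (μ := μ) v x
  have h1 : gradLen G ω μ (u - v) x ^ p ≤
      2 ^ p * (gradLen G ω μ u x ^ p + gradLen G ω μ v x ^ p) :=
    (Real.rpow_le_rpow (gradLen_nonneg _ _) (gradLen_sub_le hω hμ u v x) hp0).trans
      (add_rpow_le gu gv hp0)
  have h2 : |(u - v) x| ^ p ≤ 2 ^ p * (|u x| ^ p + |v x| ^ p) :=
    (Real.rpow_le_rpow (abs_nonneg _) (abs_sub (u x) (v x)) hp0).trans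
      (add_rpow_le (abs_nonneg _) (abs_nonneg _) hp0)
  have k1 := gradLen_rpow_mul_le (G := G) (ω := ω) (p := p) hμ hhp u x
  have k2 := gradLen_rpow_mul_le (G := G) (ω := ω) (p := p) hμ hhp v x
  have k3 := abs_rpow_mul_le_div (G := G) (ω := ω) (p := p) hμ hh₀ u (hh x)
  have k4 := abs_rpow_mul_le_div (G := G) (ω := ω) (p := p) hμ hh₀ v (hh x)
  calc energyDensity G ω μ p (fun _ => 1) (u - v) x
      = (gradLen G ω μ (u - v) x ^ p + |(u - v) x| ^ p) * μ x := by
        rw [energyDensity, one_mul]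
    _ ≤ (2 ^ p * (gradLen G ω μ u x ^ p + gradLen G ω μ v x ^ p) +
          2 ^ p * (|u x| ^ p + |v x| ^ p)) * μ x := by gcongr
    _ = 2 ^ p * (gradLen G ω μ u x ^ p * μ x + gradLen G ω μ v x ^ p * μ x +
          |u x| ^ p * μ x + |v x| ^ p * μ x) := by ring
    _ ≤ 2 ^ p * (energyDensity G ω μ p h u x + energyDensity G ω μ p h v x +
          energyDensity G ω μ p h u x / h₀ + energyDensity G ω μ p h v x / h₀) := by gcongr
    _ = _ := by ring

/-- Convergence of the pairing of the operator at `u` with a bounded, pointwise convergent family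
of test functions. -/
theorem tendsto_tsum_weakIntegrand {ι : Type*} {l : Filter ι} [l.NeBot]
    (hω : ∀ x y, G.Adj x y → 0 < ω x y) (hμ : ∀ x, 0 < μ x) (hp : 1 < p) (hh : ∀ x, 0 ≤ h x)
    {u φ : V → ℝ} {ψ : ι → V → ℝ} {C C' : ℝ}
    (hu : ∀ T : Finset V, ∑ x ∈ T, energyDensity G ω μ p h u x ≤ C)
    (hψ : ∀ i, ∀ T : Finset V, ∑ x ∈ T, energyDensity G ω μ p h (ψ i) x ≤ C')
    (hlim : Tendsto ψ l (𝓝 φ)) :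
    Summable (fun x => weakIntegrand G ω μ p h u φ x * μ x) ∧
      Tendsto (fun i => ∑' x, weakIntegrand G ω μ p h u (ψ i) x * μ x) l
        (𝓝 (∑' x, weakIntegrand G ω μ p h u φ x * μ x)) := by
  have hus := summable_of_sum_le (energyDensity_nonneg hμ hh u) hu
  have gl0 : ∀ u x, 0 ≤ gradLen G ω μ u x := gradLen_nonneg
  obtain ⟨a1, a2, a3⟩ := tendsto_tsum_of_young (l := l) (p := p) (C := C') (w := μ)
    (A := fun x => gradLen G ω μ u x ^ (p - 1)) (B := fun i x => gradLen G ω μ (ψ i) x)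
    (f := fun i x => gradLen G ω μ u x ^ (p - 2) * gradForm G ω μ u (ψ i) x * μ x)
    (f₀ := fun x => gradLen G ω μ u x ^ (p - 2) * gradForm G ω μ u φ x * μ x) hp
    (fun x => (hμ x).le) (fun x => Real.rpow_nonneg (gl0 u x) _) (fun i x => gl0 _ x)
    (Summable.of_nonneg_of_le
      (fun x => mul_nonneg (Real.rpow_nonneg (Real.rpow_nonneg (gl0 u x) _) _) (hμ x).le)
      (fun x => by rw [rpow_sub_one_rpow hp (gl0 u x)]; exact gradLen_rpow_mul_le hμ hh u x) hus)
    (fun i T => (Finset.sum_le_sum fun x _ => gradLen_rpow_mul_le hμ hh (ψ i) x).trans (hψ i T))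
    (fun i x => by
      rw [abs_mul, abs_of_pos (hμ x)]
      exact mul_le_mul_of_nonneg_right (abs_flux_le hω hμ p u (ψ i) x) (hμ x).le)
    (fun x => ((((continuous_gradForm_right u x).tendsto φ).comp hlim).const_mul _).mul_const _)
  -- The potential is put into the measure: the energy bounds both functions in L^p of h μ.
  obtain ⟨b1, b2, b3⟩ := tendsto_tsum_of_young (l := l) (p := p) (C := C')
    (w := fun x => h x * μ x)
    (A := fun x => |u x| ^ (p - 1)) (B := fun i x => |ψ i x|)
    (f := fun i x => h x * |u x| ^ (p - 2) * u x * ψ i x * μ x)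
    (f₀ := fun x => h x * |u x| ^ (p - 2) * u x * φ x * μ x) hp
    (fun x => mul_nonneg (hh x) (hμ x).le) (fun x => Real.rpow_nonneg (abs_nonneg _) _)
    (fun i x => abs_nonneg _)
    (Summable.of_nonneg_of_le
      (fun x => mul_nonneg (Real.rpow_nonneg (Real.rpow_nonneg (abs_nonneg _) _) _)
        (mul_nonneg (hh x) (hμ x).le))
      (fun x => by rw [rpow_sub_one_rpow hp (abs_nonneg _)]; exact abs_rpow_mul_le hμ u x) hus)
    (fun i T => (Finset.sum_le_sum fun x _ => abs_rpow_mul_le hμ (ψ i) x).trans (hψ i T))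
    (fun i x => by
      rw [← abs_rpow_sub_two_mul hp]
      refine le_of_eq ?_
      rw [← abs_of_nonneg (mul_nonneg (hh x) (hμ x).le), ← abs_mul, ← abs_mul]
      congr 1
      ring)
    (fun x => ((tendsto_pi_nhds.1 hlim x).const_mul _).mul_const _)
  have e : ∀ φ x, weakIntegrand G ω μ p h u φ x * μ x =
      gradLen G ω μ u x ^ (p - 2) * gradForm G ω μ u φ x * μ x +
        h x * |u x| ^ (p - 2) * u x * φ x * μ x := fun φ x => by rw [weakIntegrand, add_mul]
  simp only [e]
  refine ⟨a2.add b2, ?_⟩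
  rw [a2.tsum_add b2]
  simp only [fun i => (a1 i).tsum_add (b1 i)]
  exact a3.add b3

/-- Convergence of the pairing of a function of subcritical growth with a bounded, pointwise
convergent family of test functions. -/
theorem tendsto_tsum_mul {ι : Type*} {l : Filter ι} [l.NeBot] {h₀ M : ℝ}
    (hμ : ∀ x, 0 < μ x) (hp : 1 < p) (hh₀ : 0 < h₀) (hh : ∀ x, h₀ ≤ h x)
    (hM : 0 ≤ M) {g : V → ℝ} (hg₀ : ∀ x, 0 ≤ g x)
    (hg : Summable fun x => g x ^ (p / (p - 1)) * μ x)
    {u φ k : V → ℝ} {ψ : ι → V → ℝ} {C C' : ℝ}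
    (hk : ∀ x, |k x| ≤ M * |u x| ^ (p - 1) + g x)
    (hu : ∀ T : Finset V, ∑ x ∈ T, energyDensity G ω μ p h u x ≤ C)
    (hψ : ∀ i, ∀ T : Finset V, ∑ x ∈ T, energyDensity G ω μ p h (ψ i) x ≤ C')
    (hlim : Tendsto ψ l (𝓝 φ)) :
    Summable (fun x => k x * φ x * μ x) ∧
      Tendsto (fun i => ∑' x, k x * ψ i x * μ x) l (𝓝 (∑' x, k x * φ x * μ x)) := by
  have hhp : ∀ x, 0 ≤ h x := fun x => hh₀.le.trans (hh x)
  have hq : 0 ≤ p / (p - 1) := div_nonneg (by linarith) (by linarith)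
  have hus := summable_of_sum_le (energyDensity_nonneg hμ hhp u) hu
  refine (tendsto_tsum_of_young (l := l) (p := p) (C := C' / h₀) (w := μ)
    (A := fun x => |k x|) (B := fun i x => |ψ i x|) hp
    (fun x => (hμ x).le) (fun x => abs_nonneg _) (fun i x => abs_nonneg _)
    ?_ ?_ ?_ (fun x => ((tendsto_pi_nhds.1 hlim x).const_mul _).mul_const _)).2
  · refine Summable.of_nonneg_of_le
      (fun x => mul_nonneg (Real.rpow_nonneg (abs_nonneg _) _) (hμ x).le) (fun x => ?_)
      (((hus.div_const h₀).mul_left (2 ^ (p / (p - 1)) * M ^ (p / (p - 1)))).add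
        (hg.mul_left (2 ^ (p / (p - 1)))))
    have hμx := hμ x
    have h1 := abs_rpow_mul_le_div (G := G) (ω := ω) (p := p) hμ hh₀ u (hh x)
    have h2 : 0 ≤ |u x| ^ (p - 1) := Real.rpow_nonneg (abs_nonneg _) _
    have h3 : |k x| ^ (p / (p - 1)) ≤
        2 ^ (p / (p - 1)) * (M ^ (p / (p - 1)) * |u x| ^ p + g x ^ (p / (p - 1))) := by
      refine (Real.rpow_le_rpow (abs_nonneg _) (hk x) hq).trans
        ((add_rpow_le (by positivity) (hg₀ x) hq).trans ?_)
      rw [Real.mul_rpow hM h2, rpow_sub_one_rpow hp (abs_nonneg _)]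
    calc |k x| ^ (p / (p - 1)) * μ x
        ≤ 2 ^ (p / (p - 1)) * (M ^ (p / (p - 1)) * |u x| ^ p + g x ^ (p / (p - 1))) * μ x := by
          gcongr
      _ = 2 ^ (p / (p - 1)) * M ^ (p / (p - 1)) * (|u x| ^ p * μ x) +
          2 ^ (p / (p - 1)) * (g x ^ (p / (p - 1)) * μ x) := by ring
      _ ≤ _ := by gcongr
  · intro i T
    calc ∑ x ∈ T, |ψ i x| ^ p * μ x
        ≤ ∑ x ∈ T, energyDensity G ω μ p h (ψ i) x / h₀ :=
          Finset.sum_le_sum fun x _ => abs_rpow_mul_le_div hμ hh₀ (ψ i) (hh x)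
      _ = (∑ x ∈ T, energyDensity G ω μ p h (ψ i) x) / h₀ := (Finset.sum_div _ _ _).symm
      _ ≤ _ := by gcongr; exact hψ i T
  · intro i x
    rw [abs_mul, abs_mul, abs_of_pos (hμ x)]

/-- Convergence of the pairing of the nonlinearity with the functions themselves; compactness comes
from the growth of the potential. -/
theorem tendsto_tsum_nonlinearity {ι : Type*} {l : Filter ι} [l.NeBot] {h₀ M : ℝ}
    (hμ : ∀ x, 0 < μ x) (hp : 1 < p) (hh₀ : 0 < h₀) (hh : ∀ x, h₀ ≤ h x)
    (hfin : ∀ H : ℝ, {x | h x < H}.Finite)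
    (hM : 0 ≤ M) {g : V → ℝ} (hg₀ : ∀ x, 0 ≤ g x)
    (hg : Summable fun x => g x ^ (p / (p - 1)) * μ x) {f : V → ℝ → ℝ}
    (hfc : ∀ x, Continuous (f x)) (hf : ∀ x s, |f x s| ≤ M * |s| ^ (p - 1) + g x)
    {φ : V → ℝ} {ψ : ι → V → ℝ} {C : ℝ} (hψs : ∀ i, (ψ i).support.Finite)
    (hψ : ∀ i, ∀ T : Finset V, ∑ x ∈ T, energyDensity G ω μ p h (ψ i) x ≤ C)
    (hlim : Tendsto ψ l (𝓝 φ)) :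
    Tendsto (fun i => ∑' x, f x (ψ i x) * ψ i x * μ x) l (𝓝 (∑' x, f x (φ x) * φ x * μ x)) := by
  classical
  have hhp : ∀ x, 0 ≤ h x := fun x => hh₀.le.trans (hh x)
  have hpt := tendsto_pi_nhds.1 hlim
  refine (tendsto_tsum_of_tails (fun i => ?_) (fun x => ?_) fun δ hδ => ?_).2
  · refine summable_of_hasFiniteSupport ((hψs i).subset fun x hx => ?_)
    contrapose! hx
    simp only [Function.mem_support, not_not] at hx ⊢
    rw [hx]; ring
  · exact ((((hfc x).tendsto _).comp (hpt x)).mul (hpt x)).mul_const _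
  · obtain ⟨i₀⟩ : Nonempty ι := l.nonempty_of_neBot
    have hC : 0 ≤ C := by simpa using hψ i₀ ∅
    obtain ⟨S₁, hS₁⟩ := tails_mul_of_young (p := p) (C := C / h₀) (w := μ) (A := g)
      (B := fun i x => |ψ i x|) (f := fun i x => g x * |ψ i x| * μ x) hp
      (fun x => (hμ x).le) hg₀ (fun i x => abs_nonneg _) hg (fun i T => by
        calc ∑ x ∈ T, |ψ i x| ^ p * μ x
            ≤ ∑ x ∈ T, energyDensity G ω μ p h (ψ i) x / h₀ :=
              Finset.sum_le_sum fun x _ => abs_rpow_mul_le_div hμ hh₀ (ψ i) (hh x)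
          _ = (∑ x ∈ T, energyDensity G ω μ p h (ψ i) x) / h₀ := (Finset.sum_div _ _ _).symm
          _ ≤ _ := by gcongr; exact hψ i T)
      (fun i x => by
        have := hg₀ x
        have := hμ x
        rw [abs_of_nonneg (by positivity)]) (half_pos hδ)
    -- Where h ≥ H, the sum of |ψ|^p μ is at most C/H, which makes the growth term at most δ/2; the
    -- summand 1 keeps `H` positive.
    set H := 2 * M * C / δ + 1 with hH
    have hH0 : 0 < H := by positivity
    have hHδ : M * (C / H) ≤ δ / 2 := by
      rw [← mul_div_assoc, div_le_iff₀ hH0, hH]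
      have : δ / 2 * (2 * M * C / δ + 1) = M * C + δ / 2 := by field_simp
      linarith
    refine ⟨S₁ ∪ (hfin H).toFinset, Eventually.of_forall fun i T hT => ?_⟩
    rw [Finset.disjoint_union_right] at hT
    have hTH : ∀ x ∈ T, H ≤ h x := by
      intro x hx
      have := Finset.disjoint_left.1 hT.2 hx
      simpa using this
    calc ∑ x ∈ T, |f x (ψ i x) * ψ i x * μ x|
        ≤ ∑ x ∈ T, (M * (energyDensity G ω μ p h (ψ i) x / H) + |g x * |ψ i x| * μ x|) := by
          refine Finset.sum_le_sum fun x hx => ?_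
          have hμx := hμ x
          have hgx := hg₀ x
          have h1 := abs_rpow_mul_le_div (G := G) (ω := ω) (p := p) hμ hH0 (ψ i) (hTH x hx)
          have h2 : |ψ i x| ^ (p - 1) * |ψ i x| = |ψ i x| ^ p := by
            rcases eq_or_ne (ψ i x) 0 with h0 | h0
            · simp [h0, Real.zero_rpow (by linarith : p ≠ 0)]
            · rw [← Real.rpow_add_one (abs_ne_zero.2 h0)]; ring_nf
          rw [abs_mul, abs_mul, abs_of_pos hμx,
            abs_of_nonneg (show 0 ≤ g x * |ψ i x| * μ x by positivity)]
          calc |f x (ψ i x)| * |ψ i x| * μ x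
              ≤ (M * |ψ i x| ^ (p - 1) + g x) * |ψ i x| * μ x := by gcongr; exact hf x _
            _ = M * (|ψ i x| ^ (p - 1) * |ψ i x| * μ x) + g x * |ψ i x| * μ x := by ring
            _ ≤ _ := by rw [h2]; gcongr
      _ = M * ((∑ x ∈ T, energyDensity G ω μ p h (ψ i) x) / H) +
            ∑ x ∈ T, |g x * |ψ i x| * μ x| := by
          rw [Finset.sum_add_distrib, ← Finset.mul_sum, Finset.sum_div]
      _ ≤ M * (C / H) + δ / 2 := by
          gcongr
          · exact hψ i T
          · exact hS₁ i T hT.1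
      _ ≤ δ := by linarith

end Limit

/-! ### Sobolev membership, approximation and the weak solution -/

section Existence

variable {V : Type*} {G : SimpleGraph V} [G.LocallyFinite] {ω : V → V → ℝ} {μ : V → ℝ} {p : ℝ}
  {h : V → ℝ}

/-- The first step of a shortest walk to x₀ enters the next smaller ball, so each ball lies in the
previous one plus the finitely many neighbors of its vertices. -/
theorem finite_dist_le (hG : G.Connected) (x₀ : V) (n : ℕ) : {x | G.dist x x₀ ≤ n}.Finite := by
  induction n with
  | zero =>
    refine (Set.finite_singleton x₀).subset fun x hx => ?_
    have h0 : G.dist x x₀ = 0 := Nat.le_zero.1 hx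
    exact (hG.dist_eq_zero_iff).1 h0
  | succ n ih =>
    refine (ih.union (ih.biUnion fun y _ => (G.neighborFinset y).finite_toSet)).subset
      fun x hx => ?_
    obtain ⟨w, hw⟩ := hG.exists_walk_length_eq_dist x x₀
    cases w with
    | nil => left; simp
    | @cons _ y _ hxy w =>
      right
      have h1 : G.dist y x₀ ≤ n := by
        have h2 := G.dist_le w
        have h3 : G.dist x x₀ ≤ n + 1 := hx
        rw [SimpleGraph.Walk.length_cons] at hw
        omega
      exact Set.mem_biUnion h1 (by simpa using hxy.symm)

theorem finite_sublevel (hG : G.Connected) {x₀ : V}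
    (hh : Tendsto h (comap (fun x => G.dist x x₀) atTop) atTop) (H : ℝ) :
    {x | h x < H}.Finite := by
  obtain ⟨t, ht, hsub⟩ := mem_comap.1 (hh.eventually_ge_atTop H)
  obtain ⟨n, hn⟩ := mem_atTop_sets.1 ht
  refine (finite_dist_le hG x₀ n).subset fun x hx => ?_
  by_contra hlt
  have h1 : n ≤ G.dist x x₀ := (not_le.1 hlt).le
  have h2 : H ≤ h x := hsub (hn _ h1)
  have h3 : h x < H := hx
  linarith

theorem finiteSobolevNorm_iff (u : V → ℝ) :
    FiniteSobolevNorm G ω μ p u ↔ Summable (energyDensity G ω μ p (fun _ => 1) u) := by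
  refine summable_congr fun x => ?_
  rw [energyDensity, one_mul]

theorem sobolevNorm_eq (u : V → ℝ) :
    sobolevNorm G ω μ p u = (∑' x, energyDensity G ω μ p (fun _ => 1) u x) ^ (1 / p) := by
  simp only [sobolevNorm, integralV, energyDensity, one_mul]

/-- Convergence of the energies together with pointwise convergence of finitely supported functions
implies membership in the Sobolev space. -/
theorem memWh_of_tendsto {ι : Type*} {l : Filter ι} [l.NeBot] {h₀ C : ℝ}
    (hω : ∀ x y, G.Adj x y → 0 < ω x y) (hμ : ∀ x, 0 < μ x) (hp : 1 < p) (hh₀ : 0 < h₀)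
    (hh : ∀ x, h₀ ≤ h x) {u : V → ℝ} {ψ : ι → V → ℝ} (hψs : ∀ i, (ψ i).support.Finite)
    (hψ : ∀ i, ∀ T : Finset V, ∑ x ∈ T, energyDensity G ω μ p h (ψ i) x ≤ C)
    (hus : Summable (energyDensity G ω μ p h u)) (hlim : Tendsto ψ l (𝓝 u))
    (hE : Tendsto (fun i => ∑' x, energyDensity G ω μ p h (ψ i) x) l
      (𝓝 (∑' x, energyDensity G ω μ p h u x))) :
    MemWh G ω μ p h u := by
  have hp0 : 0 < p := by linarith
  have hhp : ∀ x, 0 ≤ h x := fun x => hh₀.le.trans (hh x)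
  have h1p : ∀ _ : V, (0 : ℝ) ≤ 1 := fun _ => zero_le_one
  have hsub := energyDensity_sub_le (G := G) (ω := ω) hω hμ hp hh₀ hh
  have hc : Continuous fun v : V → ℝ => u - v := by fun_prop
  -- A Scheffé-type argument: the densities of `u - ψ i` tend to 0 pointwise and are dominated by
  -- energy densities whose sums converge.
  obtain ⟨b1, b2⟩ := tendsto_tsum_zero_of_le (l := l)
    (a := fun i => energyDensity G ω μ p h (ψ i)) (a₀ := energyDensity G ω μ p h u)
    (b := fun i => energyDensity G ω μ p (fun _ => 1) (u - ψ i))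
    (C := 2 ^ p * (1 + 1 / h₀)) (by positivity)
    (fun i => summable_of_sum_le (energyDensity_nonneg hμ hhp _) (hψ i)) hus
    (fun x => ((continuous_energyDensity hp x).tendsto u).comp hlim) hE
    (fun i x => energyDensity_nonneg hμ hhp _ x)
    (fun i x => by
      rw [abs_of_nonneg (energyDensity_nonneg hμ h1p _ x)]
      exact hsub u (ψ i) x)
    (fun x => by
      have := ((continuous_energyDensity (G := G) (ω := ω) (μ := μ) (h := fun _ => 1)
        hp x).comp hc).tendsto u
      simp only [Function.comp_apply, sub_self, energyDensity_zero hp] at this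
      exact this.comp hlim)
  refine ⟨⟨?_, fun δ hδ => ?_⟩, ?_⟩
  · rw [finiteSobolevNorm_iff]
    refine Summable.of_nonneg_of_le (energyDensity_nonneg hμ h1p u) (fun x => ?_)
      (hus.mul_left (2 ^ p * (1 + 1 / h₀)))
    simpa [energyDensity_zero hp] using hsub u 0 x
  · have h1 : Tendsto (fun i => sobolevNorm G ω μ p (u - ψ i)) l (𝓝 0) := by
      simp only [sobolevNorm_eq]
      have := b2.rpow_const (p := 1 / p) (Or.inr (by positivity))
      rwa [Real.zero_rpow (by positivity)] at this
    obtain ⟨i, hi⟩ := (h1.eventually_lt_const hδ).exists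
    exact ⟨ψ i, hψs i, (finiteSobolevNorm_iff _).2 (b1 i), hi⟩
  · refine Summable.of_nonneg_of_le
      (fun x => mul_nonneg (mul_nonneg (hhp x) (Real.rpow_nonneg (abs_nonneg _) _)) (hμ x).le)
      (fun x => ?_) hus
    have := abs_rpow_mul_le (G := G) (ω := ω) (p := p) (h := h) hμ u x
    linarith

/-- Truncating `t` between `0` and `s`. -/
noncomputable def truncate (s t : ℝ) : ℝ := max (min t (max s 0)) (min s 0)

theorem truncate_zero (s : ℝ) : truncate s 0 = 0 := by
  simp [truncate]

theorem truncate_self (s : ℝ) : truncate s s = s := by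
  simp [truncate]

theorem abs_truncate_le (s t : ℝ) : |truncate s t| ≤ |s| := by
  unfold truncate
  rcases le_total 0 s with hs | hs
  · rw [max_eq_left hs, min_eq_right hs, abs_of_nonneg hs, abs_of_nonneg (le_max_right _ _)]
    exact max_le (min_le_right _ _) hs
  · rw [max_eq_right hs, min_eq_left hs, abs_of_nonpos hs,
      abs_of_nonpos (max_le (min_le_right _ _) hs)]
    exact neg_le_neg (le_max_right _ _)

/-- `max` and `min` are 1-Lipschitz for the sup norm. The bound has the form required by
`gradLen_le_add`. -/
theorem abs_truncate_sub_le (s t s' t' : ℝ) :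
    |truncate s t - truncate s' t'| ≤ max |t - t'| |s - s'| := by
  have h1 : |max s 0 - max s' 0| ≤ |s - s'| := abs_max_sub_max_le_abs s s' 0
  have h2 : |min s 0 - min s' 0| ≤ |s - s'| := by
    simpa using abs_min_sub_min_le_max s 0 s' 0
  unfold truncate
  refine (abs_max_sub_max_le_max _ _ _ _).trans (max_le ?_ (h2.trans (le_max_right _ _)))
  exact (abs_min_sub_min_le_max _ _ _ _).trans (max_le_max le_rfl h1)

theorem continuous_truncate (s : ℝ) : Continuous (truncate s) := by
  unfold truncate; fun_prop

theorem summable_energyDensity_of_memWh {u : V → ℝ} (hu : MemWh G ω μ p h u)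
    (hμ : ∀ x, 0 < μ x) : Summable (energyDensity G ω μ p h u) := by
  have h1 : Summable fun x => gradLen G ω μ u x ^ p * μ x := by
    refine Summable.of_nonneg_of_le
      (fun x => mul_nonneg (Real.rpow_nonneg (gradLen_nonneg u x) p) (hμ x).le)
      (fun x => gradLen_rpow_mul_le hμ (fun _ => zero_le_one) u x)
      ((finiteSobolevNorm_iff u).1 hu.1.1)
  have h2 : Summable fun x => h x * |u x| ^ p * μ x := hu.2
  exact (h1.add h2).congr fun x => by rw [energyDensity, add_mul]

/-- Functions in `W_h^{1,p}` are pointwise limits of finitely supported functions with bounded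
energy. -/
theorem exists_finite_support_approx {μ₀ : ℝ} (hω : ∀ x y, G.Adj x y → 0 < ω x y)
    (hμ₀ : 0 < μ₀) (hμ : ∀ x, μ₀ ≤ μ x) (hp : 1 < p) (hh : ∀ x, 0 ≤ h x) {φ : V → ℝ}
    (hφ : MemWh G ω μ p h φ) :
    ∃ (ψ : ℕ → V → ℝ) (C : ℝ), (∀ n, (ψ n).support.Finite) ∧
      (∀ n, ∀ T : Finset V, ∑ x ∈ T, energyDensity G ω μ p h (ψ n) x ≤ C) ∧
      Tendsto ψ atTop (𝓝 φ) := by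
  have hp0 : 0 < p := by linarith
  have hμp : ∀ x, 0 < μ x := fun x => hμ₀.trans_le (hμ x)
  have h1p : ∀ _ : V, (0 : ℝ) ≤ 1 := fun _ => zero_le_one
  have hpos : ∀ n : ℕ, (0 : ℝ) < 1 / ((n : ℝ) + 1) := fun n => Nat.one_div_pos_of_nat
  choose η hη hfin hlt using fun n : ℕ => hφ.1.2 (1 / ((n : ℝ) + 1)) (hpos n)
  have hfs : ∀ n, Summable (energyDensity G ω μ p (fun _ => 1) (φ - η n)) := fun n =>
    (finiteSobolevNorm_iff _).1 (hfin n)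
  have hsmall : ∀ n, ∑' x, energyDensity G ω μ p (fun _ => 1) (φ - η n) x ≤
      (1 / ((n : ℝ) + 1)) ^ p := by
    intro n
    have h0 : 0 ≤ ∑' x, energyDensity G ω μ p (fun _ => 1) (φ - η n) x :=
      tsum_nonneg fun x => energyDensity_nonneg hμp h1p _ x
    have h1 := hlt n
    rw [sobolevNorm_eq] at h1
    have h2 := Real.rpow_le_rpow (by positivity) h1.le hp0.le
    rwa [← Real.rpow_mul h0, one_div_mul_cancel hp0.ne', Real.rpow_one] at h2
  have hφs := summable_energyDensity_of_memWh hφ hμp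
  have hη_lim : ∀ x, Tendsto (fun n => η n x) atTop (𝓝 (φ x)) := by
    intro x
    have h1 : ∀ n, |(φ - η n) x| ≤ ((1 / ((n : ℝ) + 1)) ^ p / (1 * μ₀)) ^ (1 / p) := fun n =>
      abs_le_of_energyDensity_le (G := G) (ω := ω) (h := fun _ => 1) hp one_pos (fun _ => le_rfl)
        hμ₀ hμ (((hfs n).le_tsum x fun y _ => energyDensity_nonneg hμp h1p _ y).trans (hsmall n))
    have h2 : Tendsto (fun n : ℕ => ((1 / ((n : ℝ) + 1)) ^ p / (1 * μ₀)) ^ (1 / p)) atTop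
        (𝓝 0) := by
      have := ((tendsto_one_div_add_atTop_nhds_zero_nat (𝕜 := ℝ)).rpow_const (p := p)
        (Or.inr hp0.le)).div_const (1 * μ₀)
      rw [Real.zero_rpow hp0.ne', zero_div] at this
      have := this.rpow_const (p := 1 / p) (Or.inr (by positivity))
      rwa [Real.zero_rpow (by positivity)] at this
    have h3 : Tendsto (fun n => (φ - η n) x) atTop (𝓝 0) := squeeze_zero_norm h1 h2
    have h4 := h3.const_sub (φ x)
    simpa using h4
  set E := ∑' x, energyDensity G ω μ p h φ x
  -- Approximants in the Sobolev norm need not have bounded ∫ h|η|^p; truncation enforces |ψ| ≤ |φ|.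
  -- The constant comes from |∇ψ| ≤ 2|∇φ| + |∇(φ - η)| and from ‖φ - η‖ ≤ 1.
  refine ⟨fun n x => truncate (φ x) (η n x), 2 ^ p * (2 ^ p * E + 1) + E, fun n => ?_, fun n T => ?_,
    tendsto_pi_nhds.2 fun x => ?_⟩
  · refine (hη n).subset fun x hx => ?_
    contrapose! hx
    simp only [Function.mem_support, not_not] at hx ⊢
    rw [hx, truncate_zero]
  · have hle : ∀ x, energyDensity G ω μ p h (fun x => truncate (φ x) (η n x)) x ≤
        2 ^ p * (2 ^ p * energyDensity G ω μ p h φ x +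
          energyDensity G ω μ p (fun _ => 1) (φ - η n) x) + energyDensity G ω μ p h φ x := by
      intro x
      have g0 := gradLen_nonneg (G := G) (ω := ω) (μ := μ) φ x
      have g1 := gradLen_nonneg (G := G) (ω := ω) (μ := μ) (φ - η n) x
      have h1 : gradLen G ω μ (fun x => truncate (φ x) (η n x)) x ≤
          2 * gradLen G ω μ φ x + gradLen G ω μ (φ - η n) x := by
        have h2 := gradLen_le_add (w := fun x => truncate (φ x) (η n x)) hω hμp
          (fun x y => abs_truncate_sub_le (φ y) (η n y) (φ x) (η n x)) x
        have h3 := gradLen_sub_le hω hμp φ (φ - η n) x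
        rw [sub_sub_cancel] at h3
        linarith
      have h2 : gradLen G ω μ (fun x => truncate (φ x) (η n x)) x ^ p ≤
          2 ^ p * (2 ^ p * gradLen G ω μ φ x ^ p + gradLen G ω μ (φ - η n) x ^ p) := by
        rw [← Real.mul_rpow zero_le_two g0]
        exact (Real.rpow_le_rpow (gradLen_nonneg _ _) h1 hp0.le).trans
          (add_rpow_le (by positivity) g1 hp0.le)
      have h3 : |truncate (φ x) (η n x)| ^ p ≤ |φ x| ^ p :=
        Real.rpow_le_rpow (abs_nonneg _) (abs_truncate_le _ _) hp0.le
      have hμx := hμp x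
      have hhx := hh x
      have k1 := gradLen_rpow_mul_le (G := G) (ω := ω) (p := p) hμp hh φ x
      have k2 := gradLen_rpow_mul_le (G := G) (ω := ω) (p := p) hμp h1p (φ - η n) x
      have k3 := abs_rpow_mul_le (G := G) (ω := ω) (p := p) (h := h) hμp φ x
      calc energyDensity G ω μ p h (fun x => truncate (φ x) (η n x)) x
          ≤ (2 ^ p * (2 ^ p * gradLen G ω μ φ x ^ p + gradLen G ω μ (φ - η n) x ^ p) +
              h x * |φ x| ^ p) * μ x := by unfold energyDensity; gcongr
        _ = 2 ^ p * (2 ^ p * (gradLen G ω μ φ x ^ p * μ x) +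
              gradLen G ω μ (φ - η n) x ^ p * μ x) + |φ x| ^ p * (h x * μ x) := by ring
        _ ≤ _ := by gcongr
    refine (Finset.sum_le_sum fun x _ => hle x).trans ?_
    rw [Finset.sum_add_distrib, ← Finset.mul_sum, Finset.sum_add_distrib, ← Finset.mul_sum]
    have k1 : ∑ x ∈ T, energyDensity G ω μ p h φ x ≤ E :=
      hφs.sum_le_tsum _ fun x _ => energyDensity_nonneg hμp hh φ x
    have k2 : ∑ x ∈ T, energyDensity G ω μ p (fun _ => 1) (φ - η n) x ≤ 1 := by
      refine ((hfs n).sum_le_tsum _ fun x _ => energyDensity_nonneg hμp h1p _ x).trans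
        ((hsmall n).trans (Real.rpow_le_one (hpos n).le ?_ hp0.le))
      rw [div_le_one (by positivity)]
      have : (0 : ℝ) ≤ n := Nat.cast_nonneg n
      linarith
    gcongr
  · have := ((continuous_truncate (φ x)).tendsto (φ x)).comp (hη_lim x)
    rwa [truncate_self] at this

/-- Existence of a weak solution, for nonlinearities that grow subcritically with respect to the
lower bound of the potential. -/
theorem exists_weak_solution {h₀ μ₀ M : ℝ} {g : V → ℝ} {f Φ : V → ℝ → ℝ}
    (hω : ∀ x y, G.Adj x y → 0 < ω x y)
    (hμ₀ : 0 < μ₀) (hμ : ∀ x, μ₀ ≤ μ x) (hp : 1 < p) (hh : ∀ x, h₀ ≤ h x)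
    (hfin : ∀ H : ℝ, {x | h x < H}.Finite)
    (hM₀ : 0 ≤ M) (hM : M < h₀) (hg₀ : ∀ x, 0 ≤ g x)
    (hg : Summable fun x => g x ^ (p / (p - 1)) * μ x)
    (hΦ : ∀ x s, HasDerivAt (Φ x) (f x s) s) (hΦ₀ : ∀ x, Φ x 0 = 0)
    (hfc : ∀ x, Continuous (f x)) (hf : ∀ x s, |f x s| ≤ M * |s| ^ (p - 1) + g x) :
    ∃ u : V → ℝ, IsWeakSolution G ω μ p h f u ∧ ∀ φ : V → ℝ, φ.support.Finite →
      ∑' x, weakIntegrand G ω μ p h u φ x * μ x = ∑' x, f x (u x) * φ x * μ x := by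
  classical
  have hh₀ : 0 < h₀ := by linarith
  have hμp : ∀ x, 0 < μ x := fun x => hμ₀.trans_le (hμ x)
  have hhp : ∀ x, 0 ≤ h x := fun x => hh₀.le.trans (hh x)
  obtain ⟨C, hC, hsol⟩ := exists_solution_on_finset hω hμ₀ hμ hp hh hM₀ hM hg₀ hg hΦ hΦ₀ hf
  choose v hvS hvE hveq using hsol
  have hvs : ∀ S, (v S).support.Finite := fun S => S.finite_toSet.subset fun x hx => by
    by_contra hxS
    exact hx (hvS S x hxS)
  -- An ultrafilter finer than `atTop` converges in the compact product directly, without extracting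
  -- a subsequence.
  let U : Ultrafilter (Finset V) := Ultrafilter.of atTop
  obtain ⟨u, -, hu⟩ : ∃ u ∈ {w : V → ℝ | ∀ x, w x ∈ Set.Icc (-(C / (h₀ * μ₀)) ^ (1 / p))
      ((C / (h₀ * μ₀)) ^ (1 / p))}, (U.map v : Filter (V → ℝ)) ≤ 𝓝 u := by
    refine (isCompact_pi_infinite fun x => isCompact_Icc).ultrafilter_le_nhds _ ?_
    refine le_principal_iff.2 (Filter.mem_map.2 (Filter.univ_mem' fun S x => ?_))
    exact abs_le.1 (abs_le_of_energyDensity_le hp hh₀ hh hμ₀ hμ (by simpa using hvE S {x}))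
  have hlim : Tendsto v U (𝓝 u) := hu
  have huE : ∀ T : Finset V, ∑ x ∈ T, energyDensity G ω μ p h u x ≤ C := fun T =>
    le_of_tendsto (tendsto_finsetSum T fun x _ =>
      ((continuous_energyDensity hp x).tendsto u).comp hlim) (Eventually.of_forall fun S => hvE S T)
  have hus := summable_of_sum_le (energyDensity_nonneg hμp hhp u) huE
  have hweak : ∀ φ : V → ℝ, φ.support.Finite →
      ∑' x, weakIntegrand G ω μ p h u φ x * μ x = ∑' x, f x (u x) * φ x * μ x := by
    intro φ hφ
    have hφ0 : ∀ x ∉ hφ.toFinset, φ x = 0 := by simp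
    set N := closedNhd G hφ.toFinset with hN
    have e1 : ∀ w : V → ℝ, ∑' x, weakIntegrand G ω μ p h w φ x * μ x =
        ∑ x ∈ N, weakIntegrand G ω μ p h w φ x * μ x := fun w => tsum_eq_sum fun x hx => by
      rw [weakIntegrand, gradForm_eq_zero_of_not_mem hφ0 hx,
        hφ0 x fun hS => hx (subset_closedNhd _ hS)]; simp
    have e2 : ∀ w : V → ℝ, ∑' x, f x (w x) * φ x * μ x =
        ∑ x ∈ N, f x (w x) * φ x * μ x := fun w => tsum_eq_sum fun x hx => by
      rw [hφ0 x fun hS => hx (subset_closedNhd _ hS)]; simp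
    rw [e1, e2]
    have t1 : Tendsto (fun S => ∑ x ∈ N, weakIntegrand G ω μ p h (v S) φ x * μ x) U
        (𝓝 (∑ x ∈ N, weakIntegrand G ω μ p h u φ x * μ x)) := by
      refine tendsto_finsetSum _ fun x _ => ?_
      -- As for the flux: this is p⁻¹ times the derivative of the C¹ function |s|^p.
      have hc : Continuous fun s : ℝ => |s| ^ (p - 2) * s := by
        have := ((contDiff_norm_rpow (E := ℝ) hp).continuous_deriv le_rfl).const_mul p⁻¹
        convert this using 2 with s
        simp only [Real.norm_eq_abs]
        rw [(hasDerivAt_abs_rpow s hp).deriv]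
        field_simp
      have hcw : Continuous fun w : V → ℝ => weakIntegrand G ω μ p h w φ x * μ x := by
        have h1 : Continuous fun w : V → ℝ => |w x| ^ (p - 2) * w x :=
          hc.comp (continuous_apply x)
        have h2 := (((continuous_flux hω hμp hp φ x).add
          ((h1.const_mul (h x)).mul_const (φ x))).mul_const (μ x))
        refine h2.congr fun w => ?_
        simp only [weakIntegrand, Pi.add_apply]
        ring
      exact (hcw.tendsto u).comp hlim
    have t2 : Tendsto (fun S => ∑ x ∈ N, f x (v S x) * φ x * μ x) U
        (𝓝 (∑ x ∈ N, f x (u x) * φ x * μ x)) := by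
      refine tendsto_finsetSum _ fun x _ => ?_
      exact ((((hfc x).tendsto _).comp (tendsto_pi_nhds.1 hlim x)).mul_const _).mul_const _
    refine tendsto_nhds_unique_of_eventuallyEq t1 t2 ?_
    have hU : (U : Filter (Finset V)) ≤ atTop := Ultrafilter.of_le _
    filter_upwards [hU (eventually_ge_atTop hφ.toFinset)] with S hS
    rw [← e1, ← e2]
    exact hveq S φ fun x hx => hφ0 x fun h => hx (hS h)
  have hself : ∀ w : V → ℝ, ∑' x, weakIntegrand G ω μ p h w w x * μ x =
      ∑' x, energyDensity G ω μ p h w x := fun w =>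
    tsum_congr fun x => weakIntegrand_self hω hμp hp w x
  -- `u` is not yet an admissible test function, so its equation is tested with `v S` and the limit
  -- is taken.
  have huu : ∑' x, energyDensity G ω μ p h u x = ∑' x, f x (u x) * u x * μ x := by
    have t1 := (tendsto_tsum_weakIntegrand hω hμp hp hhp huE hvE hlim).2
    have t2 := (tendsto_tsum_mul hμp hp hh₀ hh hM₀ hg₀ hg (fun x => hf x (u x)) huE hvE hlim).2
    rw [← hself]
    exact tendsto_nhds_unique_of_eventuallyEq t1 t2
      (Eventually.of_forall fun S => hweak (v S) (hvs S))
  -- Each `v S` tested against itself turns its energy into a pairing with the nonlinearity, which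
  -- converges by the compactness due to h.
  have hE : Tendsto (fun S => ∑' x, energyDensity G ω μ p h (v S) x) U
      (𝓝 (∑' x, energyDensity G ω μ p h u x)) := by
    rw [huu]
    refine (tendsto_tsum_nonlinearity hμp hp hh₀ hh hfin hM₀ hg₀ hg hfc hf hvs hvE hlim).congr
      fun S => ?_
    rw [← hself]
    exact (hveq S (v S) (hvS S)).symm
  refine ⟨u, ⟨memWh_of_tendsto hω hμp hp hh₀ hh hvs hvE hus hlim hE, fun φ hφ => ?_⟩, hweak⟩
  obtain ⟨ψ, C', hψs, hψE, hψlim⟩ := exists_finite_support_approx hω hμ₀ hμ hp hhp hφ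
  obtain ⟨s1, t1⟩ := tendsto_tsum_weakIntegrand hω hμp hp hhp huE hψE hψlim
  obtain ⟨s2, t2⟩ := tendsto_tsum_mul hμp hp hh₀ hh hM₀ hg₀ hg (fun x => hf x (u x)) huE hψE hψlim
  exact ⟨s1, s2, tendsto_nhds_unique_of_eventuallyEq t1 t2
    (Eventually.of_forall fun n => hweak (ψ n) (hψs n))⟩

/-- Solutions tested against all finitely supported functions solve the equation pointwise. -/
theorem isPointwiseSolution_of_weak (hω_symm : ∀ x y, ω x y = ω y x) (hμ : ∀ x, 0 < μ x)
    {f : V → ℝ → ℝ} {u : V → ℝ}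
    (hu : ∀ φ : V → ℝ, φ.support.Finite →
      ∑' x, weakIntegrand G ω μ p h u φ x * μ x = ∑' x, f x (u x) * φ x * μ x) :
    IsPointwiseSolution G ω μ p h f u := by
  classical
  intro z
  have h0 : ∀ x ∉ ({z} : Finset V), (Pi.single z 1 : V → ℝ) x = 0 := fun x hx => by
    rw [Pi.single_eq_of_ne (by simpa using hx)]
  have h1 := hu (Pi.single z 1) ((Set.finite_singleton z).subset Pi.support_single_subset)
  have e1 : ∑' x, weakIntegrand G ω μ p h u (Pi.single z 1) x * μ x =
      ∑ x ∈ closedNhd G {z}, weakIntegrand G ω μ p h u (Pi.single z 1) x * μ x :=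
    tsum_eq_sum fun x hx => by
      rw [weakIntegrand, gradForm_eq_zero_of_not_mem h0 hx,
        h0 x fun hS => hx (subset_closedNhd _ hS)]; simp
  have e2 : ∑' x, f x (u x) * (Pi.single z 1 : V → ℝ) x * μ x =
      f z (u z) * (Pi.single z 1 : V → ℝ) z * μ z :=
    tsum_eq_single z fun x hx => by simp [hx]
  rw [e1, e2] at h1
  simp only [weakIntegrand, add_mul] at h1
  rw [Finset.sum_add_distrib, sum_flux_single hω_symm hμ,
    Finset.sum_eq_single_of_mem z (subset_closedNhd _ (Finset.mem_singleton_self z))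
      fun x _ hx => by simp [hx]] at h1
  simp only [Pi.single_eq_same, mul_one] at h1
  rw [← add_mul] at h1
  exact mul_right_cancel₀ (hμ z).ne' h1

/-- F + K|s|^β has a minimum at 0, and for β > 1 the power contributes nothing to the derivative
there. -/
theorem deriv_eq_zero_of_neg_rpow_le {F : ℝ → ℝ} {K β : ℝ} (hβ : 1 < β)
    (hF : DifferentiableAt ℝ F 0) (hF0 : F 0 = 0) (hK : ∀ s, -K * |s| ^ β ≤ F s) :
    deriv F 0 = 0 := by
  have h1 : HasDerivAt (fun s => F s + K * |s| ^ β) (deriv F 0 + K * (β * |0| ^ (β - 2) * 0)) 0 :=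
    hF.hasDerivAt.add ((hasDerivAt_abs_rpow 0 hβ).const_mul K)
  have hmin : IsLocalMin (fun s => F s + K * |s| ^ β) 0 := by
    refine Eventually.of_forall fun s => ?_
    have := hK s
    simp only [hF0, abs_zero, Real.zero_rpow (by linarith : β ≠ 0), mul_zero, add_zero]
    linarith
  simpa using hmin.hasDerivAt_eq_zero h1

end Existence

end GraphPLaplace

/-! ### The main theorem -/

theorem theorem1p4 {V : Type*} (G : SimpleGraph V) [G.LocallyFinite] (hG : G.Connected)
    -- symmetric weights, positive on the edges
    (ω : V → V → ℝ) (hω_pos : ∀ x y, G.Adj x y → 0 < ω x y) (hω_symm : ∀ x y, ω x y = ω y x)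
    -- the measure, bounded below by a positive constant
    (μ : V → ℝ) (μ₀ : ℝ) (hμ₀ : 0 < μ₀) (hμ : ∀ x, μ₀ ≤ μ x)
    (p : ℝ) (hp : 1 < p)
    (h : V → ℝ) (F : V → ℝ → ℝ)
    (e : V → ℝ) (he : GraphPLaplace.MemLr μ (p / (p - 1)) e)
    -- (h1)
    (h₀ : ℝ) (hh₀ : 0 < h₀) (hh₁ : ∀ x, h₀ ≤ h x)
    -- (h2)
    (hh₂ : ∃ x₀ : V, Tendsto h (comap (fun x => G.dist x x₀) atTop) atTop)
    -- (f0)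
    (hf₀ : ∀ x, ContDiff ℝ 1 (F x))
    (hf₀_bound : ∃ (a : ℝ → ℝ) (b : V → ℝ),
      ContinuousOn a (Set.Ici 0) ∧ (∀ t, 0 ≤ t → 0 ≤ a t) ∧
      (∀ x, 0 ≤ b x) ∧ GraphPLaplace.MemLr μ 1 b ∧
      ∀ x s, |deriv (F x) s| ≤ a |s| * b x ∧ |F x s| ≤ a |s| * b x)
    -- (f1)
    (hf₁_zero : ∀ x, F x 0 = 0)
    (hf₁ : ∃ f₁ g₁ : V → ℝ, (∀ x, 0 ≤ f₁ x) ∧ (∀ x, 0 ≤ g₁ x) ∧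
      GraphPLaplace.MemLinfty f₁ ∧ GraphPLaplace.MemLr μ (p / (p - 1)) g₁ ∧
      GraphPLaplace.linftyNorm f₁ < h₀ ∧
      ∀ x s, |deriv (F x) s| ≤ f₁ x * |s| ^ (p - 1) + g₁ x)
    -- (f2)
    (hf₂ : ∃ (β₁ : ℝ) (K₁ : V → ℝ), 1 < β₁ ∧
      (∃ x₁, 0 < K₁ x₁ ∧ 0 < e x₁) ∧
      ∀ x s, -K₁ x * |s| ^ β₁ ≤ F x s) :
    ∀ ε : ℝ, 0 < ε →
      ∃ u : V → ℝ, u ≠ 0 ∧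
        GraphPLaplace.IsWeakSolution G ω μ p h (fun x s => deriv (F x) s + ε * e x) u ∧
        GraphPLaplace.IsPointwiseSolution G ω μ p h (fun x s => deriv (F x) s + ε * e x) u := by
  intro ε hε
  obtain ⟨x₀, hx₀⟩ := hh₂
  obtain ⟨f₁, g₁, hf₁_nonneg, hg₁_nonneg, hf₁_bdd, hg₁, hf₁_lt, hderiv⟩ := hf₁
  obtain ⟨β₁, K₁, hβ₁, ⟨x₁, -, hx₁⟩, hK₁⟩ := hf₂
  have hμp : ∀ x, 0 < μ x := fun x => hμ₀.trans_le (hμ x)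
  have hq : 0 ≤ p / (p - 1) := div_nonneg (by linarith) (by linarith)
  have hFd : ∀ x s, HasDerivAt (F x) (deriv (F x) s) s := fun x s =>
    ((hf₀ x).differentiable one_ne_zero s).hasDerivAt
  have hM : ∀ x, f₁ x ≤ GraphPLaplace.linftyNorm f₁ := fun x =>
    (le_abs_self _).trans (le_ciSup hf₁_bdd x)
  have hg : Summable fun x => (g₁ x + ε * |e x|) ^ (p / (p - 1)) * μ x := by
    have s1 : Summable fun x => |g₁ x| ^ (p / (p - 1)) * μ x := hg₁
    have s2 : Summable fun x => |e x| ^ (p / (p - 1)) * μ x := he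
    refine Summable.of_nonneg_of_le (fun x => ?_) (fun x => ?_)
      ((s1.add (s2.mul_left (ε ^ (p / (p - 1))))).mul_left (2 ^ (p / (p - 1))))
    · have := hg₁_nonneg x
      have := hμp x
      positivity
    · have h1 := GraphPLaplace.add_rpow_le (hg₁_nonneg x)
        (mul_nonneg hε.le (abs_nonneg (e x))) hq
      rw [Real.mul_rpow hε.le (abs_nonneg _)] at h1
      rw [abs_of_nonneg (hg₁_nonneg x)]
      calc _ ≤ _ := mul_le_mul_of_nonneg_right h1 (hμp x).le
        _ = _ := by ring
  -- The forcing term joins the nonlinearity: it enters `g` as ε|e| and the potential as ε e s,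
  -- leaving the growth constant ‖f₁‖_∞ < h₀ unchanged.
  obtain ⟨u, hu, hweak⟩ := GraphPLaplace.exists_weak_solution (G := G) (ω := ω) (μ := μ) (h := h)
    (M := GraphPLaplace.linftyNorm f₁) (g := fun x => g₁ x + ε * |e x|)
    (f := fun x s => deriv (F x) s + ε * e x) (Φ := fun x s => F x s + ε * e x * s)
    hω_pos hμ₀ hμ hp hh₁ (GraphPLaplace.finite_sublevel hG hx₀)
    ((hf₁_nonneg x₀).trans (hM x₀)) hf₁_lt
    (fun x => add_nonneg (hg₁_nonneg x) (mul_nonneg hε.le (abs_nonneg _))) hg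
    (fun x s => by
      simpa using (hFd x s).fun_add ((hasDerivAt_id s).const_mul (ε * e x)))
    (fun x => by simp [hf₁_zero x])
    (fun x => ((hf₀ x).continuous_deriv le_rfl).add continuous_const)
    (fun x s => by
      calc |deriv (F x) s + ε * e x| ≤ |deriv (F x) s| + |ε * e x| := abs_add_le _ _
        _ ≤ (f₁ x * |s| ^ (p - 1) + g₁ x) + ε * |e x| := by
          rw [abs_mul, abs_of_pos hε]
          gcongr
          exact hderiv x s
        _ ≤ (GraphPLaplace.linftyNorm f₁ * |s| ^ (p - 1) + g₁ x) + ε * |e x| := by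
          gcongr
          exact hM x
        _ = _ := by ring)
  have hpt := GraphPLaplace.isPointwiseSolution_of_weak
    (f := fun x s => deriv (F x) s + ε * e x) hω_symm hμp hweak
  refine ⟨u, ?_, hu, hpt⟩
  rintro rfl
  -- At the zero function the equation at x₁ reads 0 = ε e(x₁), contradicting e(x₁) > 0.
  have h1 := hpt x₁
  have h2 := GraphPLaplace.deriv_eq_zero_of_neg_rpow_le hβ₁ (hFd x₁ 0).differentiableAt
    (hf₁_zero x₁) (hK₁ x₁)
  simp only [GraphPLaplace.pLaplacian, Pi.zero_apply, sub_self, mul_zero, Finset.sum_const_zero,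
    neg_zero, add_zero, h2, zero_add] at h1
  exact (mul_pos hε hx₁).ne h1
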